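/- Let $k,\ell\in L_{1,loc}([0,\infty))$ be such that $k$ is nonnegative and nonincreasing on $(0,\infty)$ and $(k*\ell)(t)=\int_0^t k(t-s)\ell(s)\,ds=1$ for (almost all) $t\in(0,\infty)$; that is, $(k,\ell)\in(\mathcal{PC})$. Let $d\ge 1$ be an integer, and let either $\rho=2$, or $\rho=1$ and $d=1$. Write $\widehat{k}(\lambda)=\int_0^\infty e^{-\lambda t}k(t)\,dt$ for $\lambda>0$. For $\tau\ge 0$ let $w(\cdot,\tau)$ be the unique nondecreasing, left-continuous function of bounded variation on $[0,\infty)$ with $w(0,\tau)=0$ and $$\int_0^\infty e^{-\lambda t}w(t,\tau)\,dt=\frac{1}{\lambda}\,e^{-\tau\lambda\widehat{k}(\lambda)},\qquad \lambda>0 .$$ For $t>0$ the function $w(t,\cdot)$ is nonincreasing on $[0,\infty)$, and $-w(t,d\tau)$ denotes its (nonnegative) Lebesgue–Stieltjes measure. For $\tau>0$ let $$\eta^\rho_\tau(x)=(2\pi)^{-d}\int_{\mathbb{R}^d}e^{ix\cdot\xi}e^{-\tau|\xi|^\rho}\,d\xi,\qquad x\in\mathbb{R}^d,$$ be the density of the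 convolution semigroup with symbol $|\xi|^\rho$ (the Gaussian semigroup if $\rho=2$, the Cauchy semigroup if $\rho=d=1$). Define $$Z(t,x)=-\int_0^\infty\eta^\rho_\tau(x)\,w(t,d\tau),\qquad t>0,\ x\in\mathbb{R}^d .$$ Then the following hold. 1. For every $t>0$ the function $Z(t,\cdot)$ is integrable and $\int_{\mathbb{R}^d}Z(t,x)\,dx=1$. 2. The Volterra equation of the first kind $(Y(\cdot,x)*k)(t)=Z(t,x)$ has a solution, i.e. there is a jointly measurable $Y$ on $(0,\infty)\times\mathbb{R}^d$ such that for almost all $x$ one has $Y(\cdot,x)\in L_{1,loc}([0,\infty))$ and the equation holds for almost all $t>0$. For every such solution $Y$ and for almost all $t>0$, the function $Y(t,\cdot)$ is integrable and $\int_{\mathbb{R}^d}Y(t,x)\,dx=\ell(t)$. -/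

import Mathlib

open MeasureTheory Set

noncomputable section

namespace Subordination

/-- Convolution on the positive half-line, `(f * g)(t) = ∫₀ᵗ f (t - s) g s ds`. -/
def timeConv (f g : ℝ → ℝ) (t : ℝ) : ℝ :=
  ∫ s in (0 : ℝ)..t, f (t - s) * g s

/-- Kernel pairs `(k, ℓ)` of type `(PC)`: both are locally integrable on `[0, ∞)`, `k` is nonnegative
and nonincreasing on `(0, ∞)`, and `k * ℓ = 1` on `(0, ∞)`. As `ℓ` is only an `L¹_loc` function,
the last identity is one of almost everywhere defined functions. -/
structure IsPC (k ℓ : ℝ → ℝ) : Prop where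
  locallyIntegrable_k : LocallyIntegrableOn k (Ici 0)
  nonneg_k : ∀ t, 0 < t → 0 ≤ k t
  antitone_k : AntitoneOn k (Ioi 0)
  locallyIntegrable_l : LocallyIntegrableOn ℓ (Ici 0)
  conv_eq_one : ∀ᵐ t ∂(volume.restrict (Ioi (0 : ℝ))), timeConv k ℓ t = 1

/-- The Laplace transform of a function on the half-line. -/
def laplace (f : ℝ → ℝ) (lam : ℝ) : ℝ :=
  ∫ t in Ioi (0 : ℝ), Real.exp (-lam * t) * f t

/-- `φ(λ) = λ k̂(λ)`. -/
def bernsteinSymbol (k : ℝ → ℝ) (lam : ℝ) : ℝ := lam * laplace k lam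

/-- The defining properties of `w(·, τ)`: it is nondecreasing and of bounded variation on `[0, ∞)`,
normalized by `w(0, τ) = 0`, left-continuous, and its Laplace transform is
`exp (-τ φ(λ)) / λ` for `λ > 0`. (These values are positive, so the Laplace integrals converge.) -/
structure IsPropagation (k : ℝ → ℝ) (τ : ℝ) (f : ℝ → ℝ) : Prop where
  monotone : MonotoneOn f (Ici 0)
  boundedVariation : BoundedVariationOn f (Ici 0)
  map_zero : f 0 = 0
  left_cont : ∀ t, 0 < t → ContinuousWithinAt f (Iic t) t
  laplace_eq : ∀ lam, 0 < lam → laplace f lam = Real.exp (-τ * bernsteinSymbol k lam) / lam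

/-- The propagation function `w(t, τ)`, `t, τ ≥ 0`: for each `τ`, the function of `t ≥ 0` singled out
by `IsPropagation`. -/
def propagation (k : ℝ → ℝ) (t τ : ℝ) : ℝ :=
  Classical.epsilon (IsPropagation k τ) t

open Classical in
/-- The Lebesgue–Stieltjes measure `-w(t, dτ)` of the nonincreasing function `w(t, ·)` on `[0, ∞)`,
which is extended to the left of `0` by the constant `w(t, 0)`. -/
def propagationMeasure (k : ℝ → ℝ) (t : ℝ) : Measure ℝ :=
  if h : Monotone (fun τ : ℝ => -propagation k t (max τ 0)) then h.stieltjesFunction.measure else 0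

/-- The density `η^ρ_τ(x)`, `τ > 0`, of the convolution semigroup on `ℝ^d` with symbol `|ξ|^ρ`, i.e.
the function with `∫ e^{-i x·ξ} η^ρ_τ(x) dx = e^{-τ |ξ|^ρ}`, given by Fourier inversion. The integral
is real because the symbol is even. -/
def stableDensity (d : ℕ) (ρ τ : ℝ) (x : EuclideanSpace ℝ (Fin d)) : ℝ :=
  ((2 * Real.pi) ^ d)⁻¹ *
    (∫ ξ : EuclideanSpace ℝ (Fin d),
      Complex.exp (Complex.I * (inner ℝ x ξ : ℝ)) * (Real.exp (-τ * ‖ξ‖ ^ ρ) : ℂ)).re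

/-- The subordinated kernel `Z(t, x) = -∫₀^∞ η^ρ_τ(x) w(t, dτ)`. -/
def Z (k : ℝ → ℝ) (d : ℕ) (ρ t : ℝ) (x : EuclideanSpace ℝ (Fin d)) : ℝ :=
  ∫ τ in Ioi (0 : ℝ), stableDensity d ρ τ x ∂(propagationMeasure k t)

/-- `Y` is a (jointly measurable) solution of the Volterra equation of the first kind
`(Y(·, x) * k)(t) = Z(t, x)`, in `L¹_loc([0, ∞))` with respect to time; as `Z` may be infinite at
`x = 0`, this is understood for almost all `x` and `t`. -/
structure IsVolterraSolution (k : ℝ → ℝ) (d : ℕ) (ρ : ℝ)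
    (Y : ℝ → EuclideanSpace ℝ (Fin d) → ℝ) : Prop where
  measurable : AEStronglyMeasurable (Function.uncurry Y)
    ((volume.restrict (Ioi (0 : ℝ))).prod volume)
  locallyIntegrable : ∀ᵐ x : EuclideanSpace ℝ (Fin d),
    LocallyIntegrableOn (fun t => Y t x) (Ici 0)
  volterra : ∀ᵐ x : EuclideanSpace ℝ (Fin d), ∀ᵐ t ∂(volume.restrict (Ioi (0 : ℝ))),
    timeConv (fun s => Y s x) k t = Z k d ρ t x

end Subordination

end

namespace Subordination

open MeasureTheory Set Filter Topology ProbabilityTheory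
open scoped ENNReal

/-! Write `φ(λ) = λ k̂(λ)`. Since `k` is nonnegative and nonincreasing, the layer-cake formula gives
`φ(λ) = ∫₀^∞ (1 - e^{-λ m(y)}) dy`, where `m(y)` is the length of `{k > y}`. Hence `e^{-τφ}` is the
Laplace transform of a sub-probability law `P_τ` on `[0, ∞)`, obtained as an infinite convolution of
compound Poisson laws (`exists_law`). These laws form a semigroup, and uniqueness of Laplace
transforms identifies `w(t, τ) = P_τ([0, t))` (`propagation_eq`).

The central identity is `k̂ ∫_τ^∞ e^{-σφ} dσ = e^{-τφ}/λ`. Inverted, it says that for almost all `t`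
one has `w(t, τ) = ∫_τ^∞ (k * P_σ)(t) dσ`, so `-w(t, dτ)` has density `(k * P_τ)(t)` on `(0, ∞)`.
Monotonicity in `t` then yields `w(t, 0+) = 1` and `w(t, ∞) = 0` for every `t > 0`; the first claim
follows by Tonelli, as each `η_τ` is a probability density.

At `τ = 0` the identity reads `k * U = 1` with the potential measure `U = ∫₀^∞ P_τ dτ`. Convolving
with `U` therefore cancels `k`, and comparison with `k * ℓ = 1` gives `U = ℓ dt` and `ℓ ≥ 0` almost
everywhere. The measure `∫₀^∞ P_τ(dt) η_τ(x) dx dτ` has time marginal `U`, so it has a density `Y(t,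
x)` with `∫ Y(t, x) dx = ℓ(t)`, and `k * Y = Z` by Tonelli. A second solution may change sign;
`nonneg_and_posPartMeasure_eq` shows that it still agrees with `Y` almost everywhere. -/

/-! ### Laplace transforms, convolutions and distribution functions of measures -/

/-- The Laplace transform of a measure on the line. -/
noncomputable def laplaceMeasure (μ : Measure ℝ) (lam : ℝ) : ℝ≥0∞ :=
  ∫⁻ t, ENNReal.ofReal (Real.exp (-lam * t)) ∂μ

lemma laplaceMeasure_conv (μ ν : Measure ℝ) [SFinite μ] [SFinite ν] (lam : ℝ) :
    laplaceMeasure (μ ∗ ν) lam = laplaceMeasure μ lam * laplaceMeasure ν lam := by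
  unfold laplaceMeasure
  rw [Measure.lintegral_conv (by fun_prop), ← lintegral_mul_const _ (by fun_prop)]
  refine lintegral_congr fun x => ?_
  rw [← lintegral_const_mul _ (by fun_prop)]
  refine lintegral_congr fun y => ?_
  rw [← ENNReal.ofReal_mul (Real.exp_pos _).le, ← Real.exp_add, mul_add]

lemma laplaceMeasure_withDensity {μ : Measure ℝ} {f : ℝ → ℝ≥0∞} (hf : Measurable f) (lam : ℝ) :
    laplaceMeasure (μ.withDensity f) lam =
      ∫⁻ t, f t * ENNReal.ofReal (Real.exp (-lam * t)) ∂μ := by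
  unfold laplaceMeasure
  rw [lintegral_withDensity_eq_lintegral_mul _ hf (by fun_prop)]
  rfl

/-- A measure whose Laplace transform is finite on `(0, ∞)` is determined by it. -/
theorem ext_of_laplaceMeasure {μ ν : Measure ℝ}
    (hμ : ∀ lam, 0 < lam → laplaceMeasure μ lam ≠ ∞)
    (h : ∀ lam, 0 < lam → laplaceMeasure μ lam = laplaceMeasure ν lam) : μ = ν := by
  -- The measures may be infinite; tilting by `e^{-t}` makes them finite, with moment generating
  -- functions finite on `x < 1`. This strip contains the imaginary axis in its interior, so the
  -- identity theorem carries equality from real arguments to characteristic functions.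
  set e : ℝ → ℝ≥0∞ := fun t => ENNReal.ofReal (Real.exp (-t)) with he
  have hem : Measurable e := by fun_prop
  have tilt : ∀ (m : Measure ℝ) (x : ℝ),
      ∫⁻ t, ENNReal.ofReal (Real.exp (x * t)) ∂(m.withDensity e) = laplaceMeasure m (1 - x) := by
    intro m x
    rw [lintegral_withDensity_eq_lintegral_mul _ hem (by fun_prop)]
    refine lintegral_congr fun t => ?_
    simp only [he, Pi.mul_apply]
    rw [← ENNReal.ofReal_mul (Real.exp_pos _).le, ← Real.exp_add]
    ring_nf
  have fin : ∀ m : Measure ℝ, (∀ lam, 0 < lam → laplaceMeasure m lam ≠ ∞) →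
      IsFiniteMeasure (m.withDensity e) := by
    intro m hm
    refine ⟨?_⟩
    have := tilt m 0
    simp only [zero_mul, Real.exp_zero, ENNReal.ofReal_one, lintegral_const, one_mul] at this
    rw [this]
    exact (hm _ (by norm_num)).lt_top
  have int : ∀ m : Measure ℝ, (∀ lam, 0 < lam → laplaceMeasure m lam ≠ ∞) →
      Iio 1 ⊆ interior (ProbabilityTheory.integrableExpSet id (m.withDensity e)) := by
    intro m hm
    refine interior_maximal (fun x hx => ?_) isOpen_Iio
    refine ⟨by fun_prop, ?_⟩
    rw [hasFiniteIntegral_iff_norm]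
    simp only [Real.norm_eq_abs, Real.abs_exp, id]
    rw [tilt]
    exact (hm _ (by simpa using hx)).lt_top
  have hν : ∀ lam, 0 < lam → laplaceMeasure ν lam ≠ ∞ := fun l hl => h l hl ▸ hμ l hl
  have := fin μ hμ
  have := fin ν hν
  have mg : ∀ x < (1 : ℝ), ProbabilityTheory.mgf id (μ.withDensity e) x =
      ProbabilityTheory.mgf id (ν.withDensity e) x := by
    intro x hx
    simp only [ProbabilityTheory.mgf, id]
    rw [integral_eq_lintegral_of_nonneg_ae (ae_of_all _ fun t => (Real.exp_pos _).le)
        (by fun_prop),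
      integral_eq_lintegral_of_nonneg_ae (ae_of_all _ fun t => (Real.exp_pos _).le)
        (by fun_prop), tilt, tilt, h _ (by linarith)]
  have key : EqOn (ProbabilityTheory.complexMGF id (μ.withDensity e))
      (ProbabilityTheory.complexMGF id (ν.withDensity e)) {z | z.re ∈ Iio (1 : ℝ)} := by
    have hX : AnalyticOnNhd ℂ (ProbabilityTheory.complexMGF id (μ.withDensity e))
        {z | z.re ∈ Iio (1 : ℝ)} :=
      ProbabilityTheory.analyticOnNhd_complexMGF.mono fun z hz => int μ hμ hz
    have hY : AnalyticOnNhd ℂ (ProbabilityTheory.complexMGF id (ν.withDensity e))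
        {z | z.re ∈ Iio (1 : ℝ)} :=
      ProbabilityTheory.analyticOnNhd_complexMGF.mono fun z hz => int ν hν hz
    refine AnalyticOnNhd.eqOn_of_preconnected_of_frequently_eq hX hY
      ((convex_Iio (1 : ℝ)).linear_preimage Complex.reLm).isPreconnected
      (z₀ := ((0 : ℝ) : ℂ)) (by simp) ?_
    have h_real : ∃ᶠ (x : ℝ) in 𝓝[≠] 0, ProbabilityTheory.complexMGF id (μ.withDensity e) x =
        ProbabilityTheory.complexMGF id (ν.withDensity e) x := by
      refine Eventually.frequently ?_
      filter_upwards [mem_nhdsWithin_of_mem_nhds (Iio_mem_nhds (zero_lt_one' ℝ))] with y hy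
      rw [ProbabilityTheory.complexMGF_ofReal, ProbabilityTheory.complexMGF_ofReal, mg y hy]
    rw [frequently_iff_seq_forall] at h_real ⊢
    obtain ⟨xs, hx_tendsto, hx_eq⟩ := h_real
    refine ⟨fun n ↦ xs n, ?_, fun n ↦ by simp [hx_eq]⟩
    rw [tendsto_nhdsWithin_iff] at hx_tendsto ⊢
    refine ⟨?_, by simpa using hx_tendsto.2⟩
    exact (Complex.continuous_ofReal.tendsto 0).comp hx_tendsto.1
  have hmn : μ.withDensity e = ν.withDensity e := by
    refine Measure.ext_of_charFun (funext fun t => ?_)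
    rw [← ProbabilityTheory.complexMGF_id_mul_I, ← ProbabilityTheory.complexMGF_id_mul_I]
    exact key (by simp)
  have ne0 : ∀ t, e t ≠ 0 := fun t => by simp [he, Real.exp_pos]
  have net : ∀ t, e t ≠ ∞ := fun t => by simp [he]
  rw [← withDensity_inv_same hem (ae_of_all μ ne0) (ae_of_all μ net), hmn,
    withDensity_inv_same hem (ae_of_all ν ne0) (ae_of_all ν net)]

/-- The convolution of an absolutely continuous measure with a measure. -/
lemma withDensity_conv {f : ℝ → ℝ≥0∞} (hf : Measurable f) (μ : Measure ℝ) [SFinite μ] :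
    (volume.withDensity f) ∗ μ = volume.withDensity fun t => ∫⁻ s, f (t - s) ∂μ := by
  have hm : Measurable fun t => ∫⁻ s, f (t - s) ∂μ :=
    Measurable.lintegral_prod_right' (f := fun p : ℝ × ℝ => f (p.1 - p.2)) (by fun_prop)
  refine Measure.ext_of_lintegral _ fun φ hφ => ?_
  rw [Measure.conv_comm, Measure.lintegral_conv hφ,
    lintegral_withDensity_eq_lintegral_mul _ hm hφ]
  have : ∀ s, ∫⁻ x, φ (s + x) ∂(volume.withDensity f) = ∫⁻ t, f (t - s) * φ t := by
    intro s
    rw [lintegral_withDensity_eq_lintegral_mul _ hf (by fun_prop),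
      ← lintegral_sub_right_eq_self _ s]
    simp
  simp_rw [this]
  rw [lintegral_lintegral_swap (by fun_prop)]
  refine lintegral_congr fun t => ?_
  rw [Pi.mul_apply, ← lintegral_mul_const _ (by fun_prop)]

/-- Lebesgue measure on the positive half-line. -/
noncomputable def halfLine : Measure ℝ := volume.restrict (Ioi 0)

instance : SFinite halfLine := by unfold halfLine; infer_instance

lemma halfLine_eq_withDensity : halfLine = volume.withDensity ((Ioi (0 : ℝ)).indicator 1) := by
  rw [withDensity_indicator_one measurableSet_Ioi]; rfl

/-- Convolution with Lebesgue measure on the half-line is integration and divides Laplace transforms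
by `λ`. The open half-line produces `Iio`, the left-continuous distribution function, as in the
normalization of `w`. -/
lemma halfLine_conv (μ : Measure ℝ) [SFinite μ] :
    halfLine ∗ μ = volume.withDensity fun t => μ (Iio t) := by
  rw [halfLine_eq_withDensity, withDensity_conv (measurable_one.indicator measurableSet_Ioi)]
  congr 1
  ext t
  rw [← lintegral_indicator_one measurableSet_Iio]
  refine lintegral_congr fun s => ?_
  simp [indicator]

lemma lintegral_exp_neg_Ioi {lam : ℝ} (hl : 0 < lam) :
    ∫⁻ t in Ioi (0 : ℝ), ENNReal.ofReal (Real.exp (-lam * t)) = ENNReal.ofReal lam⁻¹ := by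
  rw [← ofReal_integral_eq_lintegral_ofReal (integrableOn_exp_mul_Ioi (by linarith) 0)
    (ae_of_all _ fun t => (Real.exp_pos _).le), integral_exp_mul_Ioi (by linarith)]
  simp

lemma laplaceMeasure_halfLine {lam : ℝ} (hl : 0 < lam) :
    laplaceMeasure halfLine lam = ENNReal.ofReal lam⁻¹ := lintegral_exp_neg_Ioi hl

lemma measurable_measure_Iio (μ : Measure ℝ) : Measurable fun t => μ (Iio t) :=
  Monotone.measurable fun _ _ h => measure_mono (Iio_subset_Iio h)

lemma lintegral_exp_mul_measure_Iio (μ : Measure ℝ) [SFinite μ] {lam : ℝ} (hl : 0 < lam) :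
    ∫⁻ t, μ (Iio t) * ENNReal.ofReal (Real.exp (-lam * t)) =
      ENNReal.ofReal lam⁻¹ * laplaceMeasure μ lam := by
  rw [← laplaceMeasure_withDensity (measurable_measure_Iio μ), ← halfLine_conv,
    laplaceMeasure_conv, laplaceMeasure_halfLine hl]

/-- An independent nonnegative increment only moves mass to the right, and a defect of `ν` only
loses mass. All monotonicity in `τ` comes from here. -/
lemma conv_Iio_le {μ ν : Measure ℝ} [SFinite ν] (h0 : ν (Iio 0) = 0) (h1 : ν univ ≤ 1) (t : ℝ) :
    (μ ∗ ν) (Iio t) ≤ μ (Iio t) := by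
  rw [← lintegral_indicator_one measurableSet_Iio, ← lintegral_indicator_one measurableSet_Iio,
    Measure.lintegral_conv (measurable_one.indicator measurableSet_Iio)]
  refine lintegral_mono fun x => ?_
  calc ∫⁻ y, (Iio t).indicator (1 : ℝ → ℝ≥0∞) (x + y) ∂ν
      ≤ ∫⁻ _, (Iio t).indicator (1 : ℝ → ℝ≥0∞) x ∂ν := by
        refine lintegral_mono_ae ?_
        have : ∀ᵐ y ∂ν, y ∉ Iio (0 : ℝ) := measure_eq_zero_iff_ae_notMem.1 h0
        filter_upwards [this] with y hy
        simp only [mem_Iio, not_lt] at hy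
        by_cases h : x < t
        · simp only [indicator, mem_Iio, h, if_true]
          split_ifs <;> simp
        · have : ¬ x + y < t := by linarith
          simp [indicator, this]
    _ ≤ (Iio t).indicator 1 x := by
        rw [lintegral_const]
        exact mul_le_of_le_one_right' h1

lemma conv_Iio_zero {μ ν : Measure ℝ} [SFinite ν] (hμ : μ (Iio 0) = 0) (hν : ν (Iio 0) = 0) :
    (μ ∗ ν) (Iio 0) = 0 := by
  rw [Measure.conv, Measure.map_apply (by fun_prop) measurableSet_Iio]
  refine measure_mono_null (t := Iio 0 ×ˢ univ ∪ univ ×ˢ Iio 0) ?_ ?_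
  · rintro ⟨x, y⟩ h
    simp only [mem_preimage, mem_Iio, mem_union, mem_prod, mem_univ, and_true, true_and] at h ⊢
    by_contra! hc
    linarith [hc.1, hc.2]
  · rw [measure_union_null_iff]
    simp [Measure.prod_prod, hμ, hν]

lemma conv_univ (μ ν : Measure ℝ) [SFinite ν] : (μ ∗ ν) univ = μ univ * ν univ := by
  rw [Measure.conv, Measure.map_apply (by fun_prop) MeasurableSet.univ, preimage_univ,
    ← univ_prod_univ, Measure.prod_prod]

/-- For `x, y ≥ 0` the condition `x + y < t` forces `x < t` and `y < t`. Thus local finiteness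
survives convolution. -/
lemma conv_Iio_le_mul {μ ν : Measure ℝ} [SFinite ν] (hμ : μ (Iio 0) = 0)
    (hν : ν (Iio 0) = 0) (t : ℝ) :
    (μ ∗ ν) (Iio t) ≤ μ (Iio t) * ν (Iio t) := by
  rw [Measure.conv, Measure.map_apply (by fun_prop) measurableSet_Iio, ← Measure.prod_prod]
  refine measure_mono_ae ?_
  have h : ∀ᵐ p ∂(μ.prod ν), p ∉ Iio (0 : ℝ) ×ˢ univ ∪ univ ×ˢ Iio 0 := by
    refine measure_eq_zero_iff_ae_notMem.1 ?_
    rw [measure_union_null_iff]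
    simp [Measure.prod_prod, hμ, hν]
  filter_upwards [h] with p hp hpt
  simp only [mem_union, mem_prod, mem_Iio, mem_univ, and_true, true_and, not_or, not_lt] at hp
  have hpt' : p.1 + p.2 < t := hpt
  exact ⟨by simp only [mem_Iio]; linarith [hp.2], by simp only [mem_Iio]; linarith [hp.1]⟩

lemma tendsto_measure_Iio_nhdsLT (μ : Measure ℝ) (t : ℝ) :
    Tendsto (fun s => μ (Iio s)) (𝓝[<] t) (𝓝 (μ (Iio t))) := by
  have hm : Monotone fun s => μ (Iio s) := fun _ _ h => measure_mono (Iio_subset_Iio h)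
  obtain ⟨u, hu, hlt, hu'⟩ := exists_seq_strictMono_tendsto t
  have h1 : Tendsto (fun n => μ (Iio (u n))) atTop (𝓝 (μ (Iio t))) := by
    have : Iio t = ⋃ n, Iio (u n) := by
      ext x
      simp only [mem_Iio, mem_iUnion]
      exact ⟨fun h => ((tendsto_order.1 hu').1 x h).exists, fun ⟨n, h⟩ => h.trans (hlt n)⟩
    rw [this]
    exact tendsto_measure_iUnion_atTop fun a b h => Iio_subset_Iio (hu.monotone h)
  have h2 := hm.tendsto_nhdsLT t
  have h3 := h2.comp (tendsto_nhdsWithin_iff.2 ⟨hu', Eventually.of_forall hlt⟩)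
  rwa [tendsto_nhds_unique h3 h1] at h2

/-- Locally finite measures on the half-line agree if their distribution functions agree almost
everywhere. -/
lemma ext_of_ae_Iio {μ ν : Measure ℝ} (hμ : ∀ t, μ (Iio t) ≠ ∞)
    (h : ∀ᵐ t, μ (Iio t) = ν (Iio t)) : μ = ν := by
  have all : ∀ t, μ (Iio t) = ν (Iio t) := by
    intro t
    -- A set of full measure is dense, so `t` is approached from below inside it; left continuity
    -- does the rest.
    obtain ⟨u, -, hu, hut⟩ := (Measure.dense_of_ae h).exists_seq_strictMono_tendsto t
    have hlim : Tendsto u atTop (𝓝[<] t) :=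
      tendsto_nhdsWithin_iff.2 ⟨hut, Eventually.of_forall fun n => (hu n).1⟩
    refine tendsto_nhds_unique ((tendsto_measure_Iio_nhdsLT μ t).comp hlim) ?_
    refine ((tendsto_measure_Iio_nhdsLT ν t).comp hlim).congr fun n => ?_
    exact (hu n).2.symm
  refine Measure.ext_of_generateFrom_of_iUnion (range Iio) (fun n : ℕ => Iio (n : ℝ))
    (BorelSpace.measurable_eq.trans (borel_eq_generateFrom_Iio ℝ)) isPiSystem_Iio ?_
    (fun n => ⟨n, rfl⟩) (fun n => hμ n) ?_
  · exact eq_univ_of_forall fun x => mem_iUnion.2 (exists_nat_gt x)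
  · rintro _ ⟨t, rfl⟩
    exact all t

/-! ### Compound Poisson laws and infinite convolutions -/

/-- A sub-probability measure on `[0, ∞)`. -/
structure IsSubLaw (μ : Measure ℝ) : Prop where
  Iio_zero : μ (Iio 0) = 0
  univ_le : μ univ ≤ 1

namespace IsSubLaw

variable {μ ν : Measure ℝ}

lemma isFiniteMeasure (h : IsSubLaw μ) : IsFiniteMeasure μ :=
  ⟨h.univ_le.trans_lt ENNReal.one_lt_top⟩

lemma dirac_zero : IsSubLaw (Measure.dirac (0 : ℝ)) := ⟨by simp, by simp⟩

lemma conv (hμ : IsSubLaw μ) (hν : IsSubLaw ν) : IsSubLaw (μ ∗ ν) := by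
  have := hν.isFiniteMeasure
  refine ⟨conv_Iio_zero hμ.Iio_zero hν.Iio_zero, ?_⟩
  rw [conv_univ]
  exact mul_le_one' hμ.univ_le hν.univ_le

lemma Iio_le (h : IsSubLaw μ) (t : ℝ) : μ (Iio t) ≤ 1 :=
  (measure_mono (subset_univ _)).trans h.univ_le

lemma Iio_of_nonpos (h : IsSubLaw μ) {t : ℝ} (ht : t ≤ 0) : μ (Iio t) = 0 :=
  measure_mono_null (Iio_subset_Iio ht) h.Iio_zero

end IsSubLaw

lemma laplaceMeasure_dirac_zero (lam : ℝ) : laplaceMeasure (Measure.dirac 0) lam = 1 := by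
  unfold laplaceMeasure
  rw [lintegral_dirac' _ (by fun_prop)]
  simp

/-- The convolution powers of a measure. -/
noncomputable def convPow (ν : Measure ℝ) : ℕ → Measure ℝ
  | 0 => Measure.dirac 0
  | n + 1 => convPow ν n ∗ ν

lemma IsSubLaw.convPow {ν : Measure ℝ} (hν : IsSubLaw ν) (n : ℕ) : IsSubLaw (convPow ν n) := by
  induction n with
  | zero => exact IsSubLaw.dirac_zero
  | succ n ih => exact ih.conv hν

lemma laplaceMeasure_convPow {ν : Measure ℝ} (hν : IsSubLaw ν) (lam : ℝ) (n : ℕ) :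
    laplaceMeasure (convPow ν n) lam = laplaceMeasure ν lam ^ n := by
  have := hν.isFiniteMeasure
  induction n with
  | zero => simp [convPow, laplaceMeasure_dirac_zero]
  | succ n ih =>
    have := (hν.convPow n).isFiniteMeasure
    rw [convPow, laplaceMeasure_conv, ih, pow_succ]

lemma laplaceMeasure_le_one {μ : Measure ℝ} (hμ : IsSubLaw μ) {lam : ℝ} (hl : 0 ≤ lam) :
    laplaceMeasure μ lam ≤ 1 := by
  refine le_trans ?_ hμ.univ_le
  rw [← lintegral_one]
  refine lintegral_mono_ae ?_
  filter_upwards [measure_eq_zero_iff_ae_notMem.1 hμ.Iio_zero] with t ht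
  simp only [mem_Iio, not_lt] at ht
  exact ENNReal.ofReal_le_one.2 (Real.exp_le_one_iff.2 (by nlinarith))

/-- The compound Poisson law with intensity `τ` and jump law `ν`. -/
lemma exists_compoundPoisson {ν : Measure ℝ} (hν : IsSubLaw ν) {τ : ℝ} (hτ : 0 ≤ τ) :
    ∃ μ : Measure ℝ, IsSubLaw μ ∧ ∀ lam, 0 < lam → laplaceMeasure μ lam =
      ENNReal.ofReal (Real.exp (-τ * (1 - (laplaceMeasure ν lam).toReal))) := by
  -- The Poisson weights are summed once for two uses: `x = 1` bounds the total mass, and `x` equal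
  -- to the transform of `ν` gives the transform of the mixture.
  have hsum : ∀ x : ℝ, 0 ≤ x → ∑' n : ℕ, ENNReal.ofReal (Real.exp (-τ) * (τ ^ n / n.factorial)) *
      ENNReal.ofReal x ^ n = ENNReal.ofReal (Real.exp (-τ * (1 - x))) := by
    intro x hx
    have h1 : HasSum (fun n : ℕ => Real.exp (-τ) * ((τ * x) ^ n / n.factorial))
        (Real.exp (-τ) * Real.exp (τ * x)) := by
      have := NormedSpace.expSeries_div_hasSum_exp (τ * x)
      rw [← Real.exp_eq_exp_ℝ] at this
      exact this.mul_left _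
    rw [← Real.exp_add] at h1
    have h2 : -τ * (1 - x) = -τ + τ * x := by ring
    rw [h2, ← h1.tsum_eq, ENNReal.ofReal_tsum_of_nonneg _ h1.summable]
    · refine tsum_congr fun n => ?_
      rw [← ENNReal.ofReal_pow hx, ← ENNReal.ofReal_mul (by positivity)]
      congr 1
      rw [mul_pow]; ring
    · intro n; positivity
  refine ⟨Measure.sum fun n : ℕ =>
    ENNReal.ofReal (Real.exp (-τ) * (τ ^ n / n.factorial)) • convPow ν n, ⟨?_, ?_⟩, ?_⟩
  · rw [Measure.sum_apply _ measurableSet_Iio]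
    simp [(hν.convPow _).Iio_zero]
  · rw [Measure.sum_apply _ MeasurableSet.univ]
    have := hsum 1 zero_le_one
    simp only [ENNReal.ofReal_one, one_pow, mul_one, sub_self, mul_zero, Real.exp_zero] at this
    refine le_trans (ENNReal.tsum_le_tsum fun n => ?_) this.le
    rw [Measure.smul_apply, smul_eq_mul]
    exact mul_le_of_le_one_right' (hν.convPow n).univ_le
  · intro lam hl
    have hfin : laplaceMeasure ν lam ≠ ∞ :=
      ((laplaceMeasure_le_one hν hl.le).trans_lt ENNReal.one_lt_top).ne
    rw [← hsum _ ENNReal.toReal_nonneg, ENNReal.ofReal_toReal hfin, laplaceMeasure,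
      lintegral_sum_measure]
    refine tsum_congr fun n => ?_
    rw [lintegral_smul_measure, ← laplaceMeasure_convPow hν]
    rfl

/-- The infimum of a sequence of distribution functions of sub-probability laws on the half-line
agrees almost everywhere with such a distribution function. -/
lemma exists_law_iInf_Iio {Q : ℕ → Measure ℝ} (hQ : ∀ n, IsSubLaw (Q n)) :
    ∃ P : Measure ℝ, IsSubLaw P ∧ ∀ᵐ t, P (Iio t) = ⨅ n, Q n (Iio t) := by
  set W : ℝ → ℝ≥0∞ := fun t => ⨅ n, Q n (Iio t) with hW
  have hW1 : ∀ t, W t ≤ 1 := fun t => (iInf_le _ 0).trans ((hQ 0).Iio_le t)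
  have hWt : ∀ t, W t ≠ ∞ := fun t => ((hW1 t).trans_lt ENNReal.one_lt_top).ne
  have hWm : Monotone W := fun s t h => iInf_mono fun n => measure_mono (Iio_subset_Iio h)
  have hF : Monotone fun t => (W t).toReal := fun s t h => ENNReal.toReal_mono (hWt t) (hWm h)
  have hF0 : ∀ t ≤ 0, (W t).toReal = 0 := by
    intro t ht
    have : W t = 0 := le_antisymm ((iInf_le _ 0).trans ((hQ 0).Iio_of_nonpos ht).le) bot_le
    rw [this]; rfl
  -- An infimum of left-continuous functions need not be left-continuous. The law is built from the
  -- right-continuous regularization, which alters a monotone function at countably many points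
  -- only.
  set S := hF.stieltjesFunction with hS
  have hS0 : ∀ t < 0, S t = 0 := by
    intro t ht
    refine le_antisymm ?_ ?_
    · rw [hS, hF.stieltjesFunction_eq]
      exact (hF.rightLim_le ht).trans (hF0 0 le_rfl).le
    · rw [hS, hF.stieltjesFunction_eq]
      exact (hF0 t ht.le).ge.trans (hF.le_rightLim le_rfl)
  have hbot : Tendsto S atBot (𝓝 0) := by
    refine tendsto_const_nhds.congr' ?_
    filter_upwards [eventually_lt_atBot 0] with t ht using (hS0 t ht).symm
  have hS1 : ∀ t, S t ≤ 1 := by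
    intro t
    rw [hS, hF.stieltjesFunction_eq]
    refine (hF.rightLim_le (lt_add_one t)).trans ?_
    exact ENNReal.toReal_le_of_le_ofReal zero_le_one (by simpa using hW1 (t + 1))
  refine ⟨S.measure, ⟨?_, ?_⟩, ?_⟩
  · rw [S.measure_Iio hbot]
    have : Function.leftLim S 0 ≤ 0 := by
      refine le_of_tendsto (S.mono.tendsto_leftLim 0) ?_
      filter_upwards [self_mem_nhdsWithin] with t ht using (hS0 t ht).le
    simpa using this
  · have : (univ : Set ℝ) = ⋃ n : ℕ, Iic (n : ℝ) :=
      (eq_univ_of_forall fun x => mem_iUnion.2 (exists_nat_ge x)).symm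
    rw [this]
    refine le_of_tendsto' (tendsto_measure_iUnion_atTop fun a b h =>
      Iic_subset_Iic.2 (Nat.cast_le.2 h)) fun n => ?_
    rw [Function.comp_apply, S.measure_Iic hbot]
    simpa using hS1 n
  · have h1 : ∀ᵐ t, Function.leftLim S t = S t := by
      have := S.countable_leftLim_ne.measure_zero volume
      filter_upwards [measure_eq_zero_iff_ae_notMem.1 this] with t ht
      simpa using ht
    have h2 : ∀ᵐ t, ContinuousAt (fun t => (W t).toReal) t := by
      have := hF.countable_not_continuousAt.measure_zero volume
      filter_upwards [measure_eq_zero_iff_ae_notMem.1 this] with t ht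
      simpa using ht
    filter_upwards [h1, h2] with t ht1 ht2
    rw [S.measure_Iio hbot, ht1, hS, hF.stieltjesFunction_eq,
      (hF.continuousWithinAt_Ioi_iff_rightLim_eq).1 ht2.continuousWithinAt, sub_zero,
      ENNReal.ofReal_toReal (hWt t)]

/-- Infinite convolutions of sub-probability laws on the half-line. -/
lemma exists_infinite_conv {B : ℕ → Measure ℝ} (hB : ∀ n, IsSubLaw (B n)) {c : ℕ → ℝ → ℝ}
    {φ : ℝ → ℝ} (hc : ∀ n lam, 0 < lam →
      laplaceMeasure (B n) lam = ENNReal.ofReal (Real.exp (-c n lam)))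
    (hφ : ∀ lam, 0 < lam → HasSum (fun n => c n lam) (φ lam)) :
    ∃ P : Measure ℝ, IsSubLaw P ∧
      ∀ lam, 0 < lam → laplaceMeasure P lam = ENNReal.ofReal (Real.exp (-φ lam)) := by
  obtain ⟨Q, Q0, Qs⟩ : ∃ Q : ℕ → Measure ℝ, Q 0 = Measure.dirac 0 ∧ ∀ n, Q (n + 1) = Q n ∗ B n :=
    ⟨fun n => Nat.rec (Measure.dirac 0) (fun n μ => μ ∗ B n) n, rfl, fun n => rfl⟩
  have hQ : ∀ n, IsSubLaw (Q n) := by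
    intro n
    induction n with
    | zero => rw [Q0]; exact IsSubLaw.dirac_zero
    | succ n ih => rw [Qs]; exact ih.conv (hB n)
  have fB : ∀ n, IsFiniteMeasure (B n) := fun n => (hB n).isFiniteMeasure
  have fQ : ∀ n, IsFiniteMeasure (Q n) := fun n => (hQ n).isFiniteMeasure
  have hmono : ∀ n t, Q (n + 1) (Iio t) ≤ Q n (Iio t) := by
    intro n t
    rw [Qs]
    exact conv_Iio_le (hB n).Iio_zero (hB n).univ_le t
  have hL : ∀ n lam, 0 < lam → laplaceMeasure (Q n) lam =
      ENNReal.ofReal (Real.exp (-∑ i ∈ Finset.range n, c i lam)) := by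
    intro n lam hl
    induction n with
    | zero => simpa [Q0] using laplaceMeasure_dirac_zero lam
    | succ n ih =>
      rw [Qs, laplaceMeasure_conv, ih, hc n lam hl, ← ENNReal.ofReal_mul (Real.exp_pos _).le,
        ← Real.exp_add, Finset.sum_range_succ]
      ring_nf
  obtain ⟨P, hP, hPW⟩ := exists_law_iInf_Iio hQ
  have := hP.isFiniteMeasure
  refine ⟨P, hP, fun lam hl => ?_⟩
  have hlim1 : Tendsto (fun n => ENNReal.ofReal lam⁻¹ * laplaceMeasure (Q n) lam) atTop
      (𝓝 (ENNReal.ofReal lam⁻¹ * ENNReal.ofReal (Real.exp (-φ lam)))) := by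
    refine ENNReal.Tendsto.const_mul ?_ (Or.inr ENNReal.ofReal_ne_top)
    simp_rw [hL _ lam hl]
    refine ENNReal.tendsto_ofReal ?_
    exact (Real.continuous_exp.tendsto _).comp (hφ lam hl).tendsto_sum_nat.neg
  -- After division by `λ` the transforms are integrals of distribution functions. These decrease to
  -- that of `P` almost everywhere, so dominated convergence applies with `Q 0` as majorant.
  have hlim2 : Tendsto (fun n => ENNReal.ofReal lam⁻¹ * laplaceMeasure (Q n) lam) atTop
      (𝓝 (ENNReal.ofReal lam⁻¹ * laplaceMeasure P lam)) := by
    simp_rw [← lintegral_exp_mul_measure_Iio _ hl]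
    refine tendsto_lintegral_of_dominated_convergence
      (fun t => Q 0 (Iio t) * ENNReal.ofReal (Real.exp (-lam * t)))
      (fun n => (measurable_measure_Iio (Q n)).mul (by fun_prop)) ?_ ?_ ?_
    · intro n
      refine ae_of_all _ fun t => ?_
      have : Antitone fun n => Q n (Iio t) := antitone_nat_of_succ_le fun n => hmono n t
      exact mul_le_mul_left (this (Nat.zero_le n)) _
    · rw [lintegral_exp_mul_measure_Iio _ hl, hL 0 lam hl]
      exact ENNReal.mul_ne_top ENNReal.ofReal_ne_top ENNReal.ofReal_ne_top
    · filter_upwards [hPW] with t ht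
      rw [ht]
      have : Antitone fun n => Q n (Iio t) := antitone_nat_of_succ_le fun n => hmono n t
      exact ENNReal.Tendsto.mul_const (tendsto_atTop_iInf this) (Or.inr ENNReal.ofReal_ne_top)
  have hne : ENNReal.ofReal lam⁻¹ ≠ 0 := by simpa using hl
  exact (ENNReal.mul_right_inj hne ENNReal.ofReal_ne_top).1 (tendsto_nhds_unique hlim2 hlim1)

/-! ### The symbol `λ k̂(λ)` through the level sets of `k` -/

/-- The kernel `k` on `(0, ∞)`, extended by zero, with values in `[0, ∞]`. -/
noncomputable def kernelDensity (k : ℝ → ℝ) : ℝ → ℝ≥0∞ :=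
  (Ioi (0 : ℝ)).indicator fun t => ENNReal.ofReal (k t)

/-- The set on which the kernel exceeds the level `y`. -/
def superlevel (k : ℝ → ℝ) (y : ℝ) : Set ℝ := {t | 0 < t ∧ y < k t}

section Kernel

variable {k : ℝ → ℝ}

lemma ordConnected_superlevel (hk : AntitoneOn k (Ioi 0)) (y : ℝ) :
    (superlevel k y).OrdConnected := by
  refine ⟨fun a ha b hb c hc => ?_⟩
  have hc0 : 0 < c := ha.1.trans_le hc.1
  exact ⟨hc0, hb.2.trans_le (hk hc0 hb.1 hc.2)⟩

lemma measurableSet_superlevel (hk : AntitoneOn k (Ioi 0)) (y : ℝ) :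
    MeasurableSet (superlevel k y) :=
  (ordConnected_superlevel hk y).measurableSet

lemma measurable_indicator_of_antitoneOn (hk : AntitoneOn k (Ioi 0)) :
    Measurable ((Ioi (0 : ℝ)).indicator k) := by
  refine measurable_of_Ioi fun y => ?_
  have : (Ioi (0 : ℝ)).indicator k ⁻¹' Ioi y = superlevel k y ∪ {t | t ≤ 0 ∧ y < 0} := by
    ext t
    by_cases ht : 0 < t
    · simp [superlevel, ht, not_le.2 ht]
    · simp [superlevel, ht, not_lt.1 ht]
  rw [this]
  refine (measurableSet_superlevel hk y).union ?_
  exact measurableSet_Iic.inter (MeasurableSet.const _)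

lemma kernelDensity_eq (k : ℝ → ℝ) (t : ℝ) :
    kernelDensity k t = ENNReal.ofReal ((Ioi (0 : ℝ)).indicator k t) := by
  by_cases ht : 0 < t <;> simp [kernelDensity, ht]

lemma measurable_kernelDensity (hk : AntitoneOn k (Ioi 0)) : Measurable (kernelDensity k) := by
  have : kernelDensity k = fun t => ENNReal.ofReal ((Ioi (0 : ℝ)).indicator k t) :=
    funext (kernelDensity_eq k)
  rw [this]
  exact (measurable_indicator_of_antitoneOn hk).ennreal_ofReal

lemma measurableSet_prod_superlevel (hk : AntitoneOn k (Ioi 0)) :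
    MeasurableSet {p : ℝ × ℝ | p.2 ∈ superlevel k p.1} := by
  have : {p : ℝ × ℝ | p.2 ∈ superlevel k p.1} =
      {p | 0 < p.2} ∩ {p | p.1 < (Ioi (0 : ℝ)).indicator k p.2} := by
    ext p
    by_cases h : 0 < p.2 <;> simp [superlevel, h]
  rw [this]
  have hm := measurable_indicator_of_antitoneOn hk
  exact (measurableSet_lt measurable_const measurable_snd).inter
    (measurableSet_lt measurable_fst (hm.comp measurable_snd))

lemma lintegral_exp_Ioc {lam : ℝ} (hl : 0 < lam) {c : ℝ} (hc : 0 ≤ c) :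
    ∫⁻ t in Ioc 0 c, ENNReal.ofReal (lam * Real.exp (-lam * t)) =
      ENNReal.ofReal (1 - Real.exp (-lam * c)) := by
  have hcont : Continuous fun t : ℝ => lam * Real.exp (-lam * t) := by fun_prop
  rw [← ofReal_integral_eq_lintegral_ofReal
    ((hcont.integrableOn_Icc (a := 0) (b := c)).mono_set Ioc_subset_Icc_self)
    (ae_of_all _ fun t => by positivity), ← intervalIntegral.integral_of_le hc]
  congr 1
  have : ∀ x ∈ uIcc 0 c,
      HasDerivAt (fun t => -Real.exp (-lam * t)) (lam * Real.exp (-lam * x)) x := by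
    intro x _
    have := ((hasDerivAt_id x).const_mul (-lam)).exp.neg
    convert! this using 1
    simp; ring
  rw [intervalIntegral.integral_eq_sub_of_hasDerivAt this (hcont.intervalIntegrable _ _)]
  simp; ring

/-- Monotonicity of `k` makes the superlevel set an interval `(0, c)` up to a null set, and `∫₀^c λ
e^{-λt} dt = 1 - e^{-λc}`. For infinite length the integral is `1`; the indicator encodes `e^{-∞} =
0`, since `toReal` would turn `∞` into `0`. -/
lemma lintegral_exp_superlevel (hk : AntitoneOn k (Ioi 0)) {lam : ℝ} (hl : 0 < lam) (y : ℝ) :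
    (∫⁻ t in superlevel k y, ENNReal.ofReal (lam * Real.exp (-lam * t))) +
      {y | volume (superlevel k y) ≠ ∞}.indicator
        (fun y => ENNReal.ofReal (Real.exp (-lam * (volume (superlevel k y)).toReal))) y = 1 := by
  by_cases hb : BddAbove (superlevel k y)
  · set c := sSup (superlevel k y) with hc
    have hc0 : 0 ≤ c := Real.sSup_nonneg fun t ht => ht.1.le
    have h1 : superlevel k y ⊆ Ioc 0 c := fun t ht => ⟨ht.1, le_csSup hb ht⟩
    have h2 : Ioo 0 c ⊆ superlevel k y := by
      intro t ht
      have hne : (superlevel k y).Nonempty := by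
        by_contra hne
        rw [not_nonempty_iff_eq_empty] at hne
        have : c = 0 := by rw [hc, hne, Real.sSup_empty]
        linarith [ht.1, ht.2]
      obtain ⟨s, hs, hts⟩ := exists_lt_of_lt_csSup hne ht.2
      exact ⟨ht.1, hs.2.trans_le (hk ht.1 hs.1 hts.le)⟩
    have hae : superlevel k y =ᵐ[volume] Ioc 0 c :=
      h1.eventuallyLE.antisymm (Ioo_ae_eq_Ioc.symm.le.trans h2.eventuallyLE)
    have hvol : volume (superlevel k y) = ENNReal.ofReal c := by
      rw [measure_congr hae]; simp
    rw [setLIntegral_congr hae, lintegral_exp_Ioc hl hc0,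
      indicator_of_mem (by simp [hvol]), hvol, ENNReal.toReal_ofReal hc0,
      ← ENNReal.ofReal_add _ (Real.exp_pos _).le]
    · simp
    · have : Real.exp (-lam * c) ≤ 1 := Real.exp_le_one_iff.2 (by nlinarith)
      linarith
  · have h : superlevel k y = Ioi 0 := by
      refine Subset.antisymm (fun t ht => ht.1) fun t ht => ?_
      obtain ⟨s, hs, hts⟩ := not_bddAbove_iff.1 hb t
      exact ⟨ht, hs.2.trans_le (hk ht hs.1 hts.le)⟩
    rw [indicator_of_notMem (by simp [h]), h, add_zero]
    simp_rw [ENNReal.ofReal_mul hl.le]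
    rw [lintegral_const_mul _ (by fun_prop), lintegral_exp_neg_Ioi hl,
      ← ENNReal.ofReal_mul hl.le, mul_inv_cancel₀ hl.ne', ENNReal.ofReal_one]

/-- Local integrability controls `(0, 1]`; beyond `1` the kernel is bounded by `k 1`. -/
lemma laplaceMeasure_kernelDensity_ne_top (h_int : LocallyIntegrableOn k (Ici 0))
    (hk : AntitoneOn k (Ioi 0)) {lam : ℝ} (hl : 0 < lam) :
    laplaceMeasure (volume.withDensity (kernelDensity k)) lam ≠ ∞ := by
  rw [laplaceMeasure_withDensity (measurable_kernelDensity hk)]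
  have h1 : ∫⁻ t in Ioc (0 : ℝ) 1, ENNReal.ofReal (k t) ≠ ∞ := by
    have : IntegrableOn k (Ioc 0 1) := (h_int.integrableOn_compact_subset
      (fun x hx => hx.1) isCompact_Icc).mono_set Ioc_subset_Icc_self
    exact this.lintegral_lt_top.ne
  have h2 : ∫⁻ t in Ioi (0 : ℝ),
      ENNReal.ofReal (k 1) * ENNReal.ofReal (Real.exp (-lam * t)) ≠ ∞ := by
    rw [lintegral_const_mul _ (by fun_prop), lintegral_exp_neg_Ioi hl]
    exact ENNReal.mul_ne_top ENNReal.ofReal_ne_top ENNReal.ofReal_ne_top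
  refine ne_top_of_le_ne_top (ENNReal.add_ne_top.2 ⟨h1, h2⟩) ?_
  rw [← lintegral_indicator measurableSet_Ioc, ← lintegral_indicator measurableSet_Ioi,
    ← lintegral_add_right _ (Measurable.indicator (by fun_prop) measurableSet_Ioi)]
  refine lintegral_mono fun t => ?_
  rcases le_or_gt t 0 with h0 | h0
  · simp [kernelDensity, not_lt.2 h0]
  have he : ENNReal.ofReal (Real.exp (-lam * t)) ≤ 1 :=
    ENNReal.ofReal_le_one.2 (Real.exp_le_one_iff.2 (by nlinarith))
  rcases le_or_gt t 1 with h1 | h1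
  · rw [indicator_of_mem (show t ∈ Ioc 0 1 from ⟨h0, h1⟩), kernelDensity,
      indicator_of_mem (show t ∈ Ioi 0 from h0)]
    exact le_add_right (mul_le_of_le_one_right' he)
  · rw [kernelDensity, indicator_of_mem (show t ∈ Ioi 0 from h0),
      indicator_of_mem (show t ∈ Ioi 0 from h0)]
    refine le_add_left ?_
    gcongr
    exact hk (by simp) h0 h1.le

lemma laplaceMeasure_kernelDensity (h_int : LocallyIntegrableOn k (Ici 0))
    (hk : AntitoneOn k (Ioi 0)) (h0 : ∀ t, 0 < t → 0 ≤ k t) {lam : ℝ} (hl : 0 < lam) :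
    laplaceMeasure (volume.withDensity (kernelDensity k)) lam = ENNReal.ofReal (laplace k lam) := by
  have hfin := laplaceMeasure_kernelDensity_ne_top h_int hk hl
  have : laplace k lam = (laplaceMeasure (volume.withDensity (kernelDensity k)) lam).toReal := by
    unfold laplace
    rw [integral_eq_lintegral_of_nonneg_ae,
      laplaceMeasure_withDensity (measurable_kernelDensity hk),
      ← lintegral_indicator measurableSet_Ioi]
    · congr 1
      refine lintegral_congr fun t => ?_
      by_cases ht : 0 < t
      · rw [kernelDensity, indicator_of_mem (show t ∈ Ioi 0 from ht),
          indicator_of_mem (show t ∈ Ioi 0 from ht), ENNReal.ofReal_mul (Real.exp_pos _).le,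
          mul_comm]
      · simp [kernelDensity, ht]
    · filter_upwards [ae_restrict_mem measurableSet_Ioi] with t ht
      exact mul_nonneg (Real.exp_pos _).le (h0 t ht)
    · refine AEStronglyMeasurable.mul (by fun_prop) ?_
      exact (aestronglyMeasurable_indicator_iff measurableSet_Ioi).1
        (measurable_indicator_of_antitoneOn hk).aestronglyMeasurable
  rw [this, ENNReal.ofReal_toReal hfin]

/-- The layer-cake formula for the symbol `φ(λ) = λ k̂(λ)`. -/
lemma ofReal_bernsteinSymbol (h_int : LocallyIntegrableOn k (Ici 0))
    (hk : AntitoneOn k (Ioi 0)) (h0 : ∀ t, 0 < t → 0 ≤ k t) {lam : ℝ} (hl : 0 < lam) :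
    ENNReal.ofReal (bernsteinSymbol k lam) = ∫⁻ y in Ioi (0 : ℝ),
      ∫⁻ t in superlevel k y, ENNReal.ofReal (lam * Real.exp (-lam * t)) := by
  rw [bernsteinSymbol, ENNReal.ofReal_mul hl.le, ← laplaceMeasure_kernelDensity h_int hk h0 hl,
    laplaceMeasure_withDensity (measurable_kernelDensity hk),
    ← lintegral_const_mul' _ _ ENNReal.ofReal_ne_top]
  have h1 : ∀ y, ∫⁻ t in superlevel k y, ENNReal.ofReal (lam * Real.exp (-lam * t)) =
      ∫⁻ t, {p : ℝ × ℝ | p.2 ∈ superlevel k p.1}.indicator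
        (fun p => ENNReal.ofReal (lam * Real.exp (-lam * p.2))) (y, t) := by
    intro y
    rw [← lintegral_indicator (measurableSet_superlevel hk y)]
    rfl
  simp_rw [h1]
  rw [lintegral_lintegral_swap]
  · refine lintegral_congr fun t => ?_
    have h2 : ∀ y, {p : ℝ × ℝ | p.2 ∈ superlevel k p.1}.indicator
        (fun p => ENNReal.ofReal (lam * Real.exp (-lam * p.2))) (y, t) =
        (if 0 < t then Iio (k t) else ∅).indicator
          (fun _ => ENNReal.ofReal (lam * Real.exp (-lam * t))) y := by
      intro y
      by_cases ht : 0 < t <;> simp [indicator, superlevel, ht]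
    simp_rw [h2]
    by_cases ht : 0 < t
    · simp only [ht, if_true]
      rw [lintegral_indicator measurableSet_Iio, lintegral_const, Measure.restrict_restrict
        measurableSet_Iio, Measure.restrict_apply MeasurableSet.univ, univ_inter,
        inter_comm, Ioi_inter_Iio, Real.volume_Ioo, sub_zero, ENNReal.ofReal_mul hl.le,
        kernelDensity, indicator_of_mem (show t ∈ Ioi 0 from ht)]
      ring
    · simp [ht, kernelDensity]
  · refine Measurable.aemeasurable ?_
    exact Measurable.indicator (by fun_prop) (measurableSet_prod_superlevel hk)

end Kernel

/-! ### The subordinator and the propagation function -/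

lemma iUnion_Ioc_natCast : ⋃ n : ℕ, Ioc (n : ℝ) (n + 1) = Ioi 0 := by
  ext x
  simp only [mem_iUnion, mem_Ioc, mem_Ioi]
  constructor
  · rintro ⟨n, h, -⟩
    exact (Nat.cast_nonneg n).trans_lt h
  · intro hx
    refine ⟨⌈x⌉₊ - 1, ?_⟩
    have h1 : 0 < ⌈x⌉₊ := Nat.ceil_pos.2 hx
    have h2 : ((⌈x⌉₊ - 1 : ℕ) : ℝ) + 1 = ⌈x⌉₊ := by
      exact_mod_cast Nat.succ_pred_eq_of_pos h1
    rw [h2]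
    refine ⟨?_, Nat.le_ceil x⟩
    have := Nat.ceil_lt_add_one hx.le
    linarith

lemma bernsteinSymbol_nonneg {k : ℝ → ℝ} (h0 : ∀ t, 0 < t → 0 ≤ k t) {lam : ℝ} (hl : 0 < lam) :
    0 ≤ bernsteinSymbol k lam := by
  refine mul_nonneg hl.le (setIntegral_nonneg measurableSet_Ioi fun t ht => ?_)
  exact mul_nonneg (Real.exp_pos _).le (h0 t ht)

/-- The laws of the subordinator with symbol `φ(λ) = λ k̂(λ)`. -/
theorem exists_law {k : ℝ → ℝ} (h_int : LocallyIntegrableOn k (Ici 0))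
    (hk : AntitoneOn k (Ioi 0)) (h0 : ∀ t, 0 < t → 0 ≤ k t) {τ : ℝ} (hτ : 0 ≤ τ) :
    ∃ P : Measure ℝ, IsSubLaw P ∧ ∀ lam, 0 < lam →
      laplaceMeasure P lam = ENNReal.ofReal (Real.exp (-τ * bernsteinSymbol k lam)) := by
  set D : ℝ → ℝ → ℝ≥0∞ := fun lam y =>
    ∫⁻ t in superlevel k y, ENNReal.ofReal (lam * Real.exp (-lam * t)) with hD
  have hvm : Measurable fun y => volume (superlevel k y) :=
    measurable_measure_prodMk_left (measurableSet_prod_superlevel hk)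
  set g : ℝ → ℝ := fun y => (volume (superlevel k y)).toReal with hg
  have hgm : Measurable g := hvm.ennreal_toReal
  set F : Set ℝ := {y | volume (superlevel k y) ≠ ∞} with hF
  have hFm : MeasurableSet F := (measurableSet_eq_fun hvm measurable_const).compl
  -- The jumps are the lengths of `{k > y}`. Their total intensity may be infinite, so levels are
  -- cut into unit slices, each giving a jump law of mass at most one. Levels of infinite length are
  -- dropped and act as killing. By `hsum` below, `1 - laplaceMeasure (ν n) lam` is the contribution
  -- of the slice to `φ(lam)`.
  set ν : ℕ → Measure ℝ := fun n => ((volume.restrict (Ioc (n : ℝ) (n + 1))).restrict F).map g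
    with hνdef
  have hν : ∀ n, IsSubLaw (ν n) := by
    intro n
    refine ⟨?_, ?_⟩
    · rw [hνdef, Measure.map_apply hgm measurableSet_Iio]
      have : g ⁻¹' Iio 0 = ∅ := by
        ext y; simp [hg]
      simp [this]
    · rw [hνdef, Measure.map_apply hgm MeasurableSet.univ, preimage_univ]
      refine (Measure.restrict_apply_le _ _).trans ?_
      simp
  have hDm : ∀ lam, Measurable (D lam) := by
    intro lam
    have : D lam = fun y => ∫⁻ t, {p : ℝ × ℝ | p.2 ∈ superlevel k p.1}.indicator
        (fun p => ENNReal.ofReal (lam * Real.exp (-lam * p.2))) (y, t) := by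
      ext y
      rw [hD]
      simp only
      rw [← lintegral_indicator (measurableSet_superlevel hk y)]
      rfl
    rw [this]
    exact Measurable.lintegral_prod_right'
      (Measurable.indicator (by fun_prop) (measurableSet_prod_superlevel hk))
  have hsum : ∀ (n : ℕ) lam, 0 < lam →
      (∫⁻ y in Ioc (n : ℝ) (n + 1), D lam y) + laplaceMeasure (ν n) lam = 1 := by
    intro n lam hl
    rw [laplaceMeasure, hνdef, lintegral_map (by fun_prop) hgm, ← lintegral_indicator hFm,
      ← lintegral_add_left (hDm lam)]
    have : ∀ y, D lam y + F.indicator (fun y => ENNReal.ofReal (Real.exp (-lam * g y))) y = 1 :=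
      fun y => lintegral_exp_superlevel hk hl y
    simp_rw [this]
    simp
  choose B hB hBL using fun n => exists_compoundPoisson (hν n) hτ
  obtain ⟨P, hP, hPL⟩ := exists_infinite_conv hB
    (c := fun n lam => τ * (1 - (laplaceMeasure (ν n) lam).toReal))
    (φ := fun lam => τ * bernsteinSymbol k lam) (fun n lam hl => by
      rw [hBL n lam hl, neg_mul]) (fun lam hl => by
      refine HasSum.mul_left τ ?_
      have h1 : ∀ n : ℕ, 1 - (laplaceMeasure (ν n) lam).toReal =
          (∫⁻ y in Ioc (n : ℝ) (n + 1), D lam y).toReal := by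
        intro n
        have h2 := hsum n lam hl
        have hf : (∫⁻ y in Ioc (n : ℝ) (n + 1), D lam y) ≠ ∞ ∧ laplaceMeasure (ν n) lam ≠ ∞ := by
          rw [← ENNReal.add_ne_top, h2]; simp
        have := congrArg ENNReal.toReal h2
        rw [ENNReal.toReal_add hf.1 hf.2, ENNReal.toReal_one] at this
        linarith
      simp_rw [h1]
      have h3 : ∑' n : ℕ, ∫⁻ y in Ioc (n : ℝ) (n + 1), D lam y =
          ENNReal.ofReal (bernsteinSymbol k lam) := by
        rw [ofReal_bernsteinSymbol h_int hk h0 hl, ← iUnion_Ioc_natCast, lintegral_iUnion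
          (fun n => measurableSet_Ioc)]
        have := Monotone.pairwise_disjoint_on_Ioc_succ (Nat.mono_cast (α := ℝ))
        simpa using this
      have h4 : ∑' n : ℕ, ∫⁻ y in Ioc (n : ℝ) (n + 1), D lam y ≠ ∞ := by
        rw [h3]; exact ENNReal.ofReal_ne_top
      have h5 := ENNReal.hasSum_toReal h4
      rwa [← ENNReal.tsum_toReal_eq (ENNReal.ne_top_of_tsum_ne_top h4), h3,
        ENNReal.toReal_ofReal (bernsteinSymbol_nonneg h0 hl)] at h5)
  refine ⟨P, hP, fun lam hl => ?_⟩
  rw [hPL lam hl, neg_mul]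

/-- The law at time `τ` of the subordinator with symbol `φ(λ) = λ k̂(λ)`, frozen at its initial
value for `τ ≤ 0`. -/
noncomputable def law (k : ℝ → ℝ) (τ : ℝ) : Measure ℝ :=
  Classical.epsilon fun P : Measure ℝ => IsSubLaw P ∧ ∀ lam, 0 < lam →
    laplaceMeasure P lam = ENNReal.ofReal (Real.exp (-max τ 0 * bernsteinSymbol k lam))

section Law

variable {k ℓ : ℝ → ℝ}

lemma law_spec (h : IsPC k ℓ) (τ : ℝ) : IsSubLaw (law k τ) ∧ ∀ lam, 0 < lam →
    laplaceMeasure (law k τ) lam =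
      ENNReal.ofReal (Real.exp (-max τ 0 * bernsteinSymbol k lam)) :=
  Classical.epsilon_spec (exists_law h.locallyIntegrable_k h.antitone_k h.nonneg_k
    (le_max_right τ 0))

lemma isSubLaw_law (h : IsPC k ℓ) (τ : ℝ) : IsSubLaw (law k τ) := (law_spec h τ).1

lemma isFiniteMeasure_law (h : IsPC k ℓ) (τ : ℝ) : IsFiniteMeasure (law k τ) :=
  (isSubLaw_law h τ).isFiniteMeasure

lemma laplaceMeasure_law (h : IsPC k ℓ) {τ : ℝ} (hτ : 0 ≤ τ) {lam : ℝ} (hl : 0 < lam) :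
    laplaceMeasure (law k τ) lam = ENNReal.ofReal (Real.exp (-τ * bernsteinSymbol k lam)) := by
  rw [(law_spec h τ).2 lam hl, max_eq_left hτ]

lemma law_zero (h : IsPC k ℓ) : law k 0 = Measure.dirac 0 := by
  have key : ∀ lam, 0 < lam → laplaceMeasure (law k 0) lam = 1 := fun lam hl => by
    rw [laplaceMeasure_law h le_rfl hl]; simp
  refine ext_of_laplaceMeasure (fun lam hl => ?_) fun lam hl => ?_
  · rw [key lam hl]; exact ENNReal.one_ne_top
  · rw [key lam hl, laplaceMeasure_dirac_zero]

/-- The semigroup property. -/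
lemma law_add (h : IsPC k ℓ) {σ τ : ℝ} (hσ : 0 ≤ σ) (hτ : 0 ≤ τ) :
    law k (σ + τ) = law k σ ∗ law k τ := by
  have := isFiniteMeasure_law h σ
  have := isFiniteMeasure_law h τ
  refine ext_of_laplaceMeasure (fun lam hl => ?_) fun lam hl => ?_
  · rw [laplaceMeasure_law h (add_nonneg hσ hτ) hl]; exact ENNReal.ofReal_ne_top
  · rw [laplaceMeasure_conv, laplaceMeasure_law h (add_nonneg hσ hτ) hl,
      laplaceMeasure_law h hσ hl, laplaceMeasure_law h hτ hl,
      ← ENNReal.ofReal_mul (Real.exp_pos _).le, ← Real.exp_add]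
    ring_nf

lemma law_max (k : ℝ → ℝ) (τ : ℝ) : law k (max τ 0) = law k τ := by
  simp [law]

lemma exists_law_eq_conv (h : IsPC k ℓ) {σ τ : ℝ} (hστ : σ ≤ τ) :
    ∃ δ, law k τ = law k σ ∗ law k δ := by
  refine ⟨max τ 0 - max σ 0, ?_⟩
  have h1 : max σ 0 ≤ max τ 0 := max_le_max hστ le_rfl
  rw [← law_max k τ, ← law_max k σ, ← law_add h (le_max_right _ _) (sub_nonneg.2 h1)]
  simp

lemma antitone_law_Iio (h : IsPC k ℓ) (t : ℝ) : Antitone fun τ => law k τ (Iio t) := by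
  intro σ τ hστ
  obtain ⟨δ, hδ⟩ := exists_law_eq_conv h hστ
  have := isFiniteMeasure_law h δ
  simp only [hδ]
  exact conv_Iio_le (isSubLaw_law h δ).Iio_zero (isSubLaw_law h δ).univ_le t

/-- The masses of `Iio t` and of the whole line are monotone in `τ`, hence measurable, and the sets
`Iio t` generate. -/
lemma measurable_law (h : IsPC k ℓ) : Measurable (law k) := by
  have := isFiniteMeasure_law h
  have huniv : Antitone fun τ => law k τ univ := by
    intro σ τ hστ
    obtain ⟨δ, hδ⟩ := exists_law_eq_conv h hστ
    simp only [hδ, conv_univ]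
    exact mul_le_of_le_one_right' (isSubLaw_law h δ).univ_le
  refine Measurable.measure_of_isPiSystem (S := range Iio)
    (BorelSpace.measurable_eq.trans (borel_eq_generateFrom_Iio ℝ)) isPiSystem_Iio ?_
    huniv.measurable
  rintro _ ⟨t, rfl⟩
  exact (antitone_law_Iio h t).measurable

/-- The laws of the subordinator as a kernel. -/
noncomputable def lawKernel (h : IsPC k ℓ) : ProbabilityTheory.Kernel ℝ ℝ :=
  ⟨law k, measurable_law h⟩

instance (h : IsPC k ℓ) : ProbabilityTheory.IsFiniteKernel (lawKernel h) :=
  ⟨1, ENNReal.one_lt_top, fun τ => (isSubLaw_law h τ).univ_le⟩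

lemma boundedVariationOn_of_monotone {f : ℝ → ℝ} (hf : Monotone f) (h0 : ∀ t, 0 ≤ f t)
    (h1 : ∀ t, f t ≤ 1) (s : Set ℝ) : BoundedVariationOn f s := by
  refine ne_top_of_le_ne_top ENNReal.one_ne_top (iSup_le fun p => ?_)
  have : ∀ i, edist (f (p.2.1 (i + 1))) (f (p.2.1 i)) =
      ENNReal.ofReal (f (p.2.1 (i + 1)) - f (p.2.1 i)) := by
    intro i
    rw [edist_dist, Real.dist_eq, abs_of_nonneg (sub_nonneg.2 (hf (p.2.2.1 (Nat.le_succ i))))]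
  simp_rw [this]
  rw [← ENNReal.ofReal_sum_of_nonneg
    (fun i _ => sub_nonneg.2 (hf (p.2.2.1 (Nat.le_succ i)))), Finset.sum_range_sub
    (fun i => f (p.2.1 i))]
  exact ENNReal.ofReal_le_one.2 (by linarith [h0 (p.2.1 0), h1 (p.2.1 p.1)])

lemma toReal_Iio_law_le (h : IsPC k ℓ) (t τ : ℝ) : (law k τ (Iio t)).toReal ≤ 1 :=
  ENNReal.toReal_le_of_le_ofReal zero_le_one (by simpa using (isSubLaw_law h τ).Iio_le t)

/-- Existence in the characterization of `w(·, τ)`: integrating `P_τ` divides `e^{-τφ}` by `λ`, and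
masses of open half-lines are left-continuous. -/
lemma isPropagation_law (h : IsPC k ℓ) {τ : ℝ} (hτ : 0 ≤ τ) :
    IsPropagation k τ fun t => (law k τ (Iio t)).toReal := by
  have := isFiniteMeasure_law h τ
  have hm : Monotone fun t => (law k τ (Iio t)).toReal := fun s t hst =>
    ENNReal.toReal_mono (measure_ne_top _ _) (measure_mono (Iio_subset_Iio hst))
  refine ⟨hm.monotoneOn _, ?_, ?_, ?_, ?_⟩
  · exact boundedVariationOn_of_monotone hm (fun t => ENNReal.toReal_nonneg)
      (fun t => toReal_Iio_law_le h t τ) _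
  · simp [(isSubLaw_law h τ).Iio_zero]
  · intro t _
    rw [← continuousWithinAt_Iio_iff_Iic]
    exact (ENNReal.tendsto_toReal (measure_ne_top _ _)).comp (tendsto_measure_Iio_nhdsLT _ t)
  · intro lam hl
    unfold laplace
    rw [integral_eq_lintegral_of_nonneg_ae
      (ae_of_all _ fun t => mul_nonneg (Real.exp_pos _).le ENNReal.toReal_nonneg)
      (by
        have := hm.measurable
        exact (Measurable.mul (by fun_prop) this).aestronglyMeasurable)]
    have h1 : ∫⁻ t in Ioi (0 : ℝ),
        ENNReal.ofReal (Real.exp (-lam * t) * (law k τ (Iio t)).toReal) =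
        ∫⁻ t, law k τ (Iio t) * ENNReal.ofReal (Real.exp (-lam * t)) := by
      rw [← lintegral_indicator measurableSet_Ioi]
      refine lintegral_congr fun t => ?_
      by_cases ht : 0 < t
      · rw [indicator_of_mem (show t ∈ Ioi 0 from ht), ENNReal.ofReal_mul (Real.exp_pos _).le,
          ENNReal.ofReal_toReal (measure_ne_top _ _), mul_comm]
      · rw [indicator_of_notMem (show t ∉ Ioi 0 from ht),
          (isSubLaw_law h τ).Iio_of_nonpos (not_lt.1 ht), zero_mul]
    rw [h1, lintegral_exp_mul_measure_Iio _ hl, laplaceMeasure_law h hτ hl,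
      ← ENNReal.ofReal_mul (by positivity), ENNReal.toReal_ofReal (by positivity)]
    ring

/-- The propagation function is the distribution function of the subordinator. -/
lemma propagation_eq (h : IsPC k ℓ) {t τ : ℝ} (ht : 0 < t) (hτ : 0 ≤ τ) :
    propagation k t τ = (law k τ (Iio t)).toReal := by
  have hf : IsPropagation k τ (Classical.epsilon (IsPropagation k τ)) :=
    Classical.epsilon_spec ⟨_, isPropagation_law h hτ⟩
  have hlaw := isPropagation_law h hτ
  unfold propagation
  set f := Classical.epsilon (IsPropagation k τ) with hfdef
  have := isFiniteMeasure_law h τ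
  have hf0 : ∀ t, 0 < t → 0 ≤ f t := fun t ht => by
    rw [← hf.map_zero]; exact hf.monotone (by simp) ht.le ht.le
  have hmeas : Measurable ((Ioi (0 : ℝ)).indicator f) := by
    have h1 : AntitoneOn (fun t => -f t) (Ioi 0) := fun a ha b hb hab =>
      neg_le_neg (hf.monotone (Ioi_subset_Ici_self ha) (Ioi_subset_Ici_self hb) hab)
    have h2 := (measurable_indicator_of_antitoneOn h1).neg
    convert h2 using 1
    ext t
    by_cases ht : 0 < t <;> simp [ht]
  have hL : ∀ lam, 0 < lam → laplaceMeasure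
      (volume.withDensity fun t => ENNReal.ofReal ((Ioi (0 : ℝ)).indicator f t)) lam =
      ENNReal.ofReal (Real.exp (-τ * bernsteinSymbol k lam) / lam) := by
    intro lam hl
    rw [laplaceMeasure_withDensity hmeas.ennreal_ofReal, ← hf.laplace_eq lam hl]
    unfold laplace
    -- A nonintegrable function has Bochner integral zero, but the prescribed transform is positive.
    have h_int : Integrable (fun t => Real.exp (-lam * t) * f t) (volume.restrict (Ioi 0)) := by
      by_contra hni
      have h1 := hf.laplace_eq lam hl
      rw [laplace, integral_undef hni] at h1
      have : 0 < Real.exp (-τ * bernsteinSymbol k lam) / lam := by positivity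
      linarith
    rw [ofReal_integral_eq_lintegral_ofReal h_int, ← lintegral_indicator measurableSet_Ioi]
    · refine lintegral_congr fun t => ?_
      by_cases ht : 0 < t
      · rw [indicator_of_mem (show t ∈ Ioi 0 from ht), indicator_of_mem (show t ∈ Ioi 0 from ht),
          ENNReal.ofReal_mul (Real.exp_pos _).le, mul_comm]
      · simp [ht]
    · filter_upwards [ae_restrict_mem measurableSet_Ioi] with t ht
      exact mul_nonneg (Real.exp_pos _).le (hf0 t ht)
  have heq : (volume.withDensity fun t => ENNReal.ofReal ((Ioi (0 : ℝ)).indicator f t)) =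
      volume.withDensity fun t => law k τ (Iio t) := by
    refine ext_of_laplaceMeasure (fun lam hl => ?_) fun lam hl => ?_
    · rw [hL lam hl]; exact ENNReal.ofReal_ne_top
    · rw [hL lam hl, ← halfLine_conv, laplaceMeasure_conv, laplaceMeasure_halfLine hl,
        laplaceMeasure_law h hτ hl, ← ENNReal.ofReal_mul (by positivity), div_eq_inv_mul]
  have hae := (withDensity_eq_iff_of_sigmaFinite hmeas.ennreal_ofReal.aemeasurable
    (measurable_measure_Iio _).aemeasurable).1 heq
  -- Laplace uniqueness identifies the functions almost everywhere; left continuity of both upgrades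
  -- this to the given `t`.
  obtain ⟨u, -, hu, hut⟩ := (Measure.dense_of_ae hae).exists_seq_strictMono_tendsto t
  have hlim : Tendsto u atTop (𝓝[Iic t] t) :=
    tendsto_nhdsWithin_iff.2 ⟨hut, Eventually.of_forall fun n => Iio_subset_Iic_self (hu n).1⟩
  refine tendsto_nhds_unique ((hf.left_cont t ht).tendsto.comp hlim) ?_
  refine ((hlaw.left_cont t ht).tendsto.comp hlim).congr' ?_
  filter_upwards [hut.eventually (lt_mem_nhds ht)] with n hn
  have h1 : ENNReal.ofReal ((Ioi (0 : ℝ)).indicator f (u n)) = law k τ (Iio (u n)) := (hu n).2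
  rw [indicator_of_mem (show u n ∈ Ioi 0 from hn)] at h1
  simp only [Function.comp_apply, ← h1, ENNReal.toReal_ofReal (hf0 _ hn)]

lemma antitone_propagation (h : IsPC k ℓ) {t : ℝ} (ht : 0 < t) :
    Monotone fun τ : ℝ => -propagation k t (max τ 0) := by
  intro σ τ hστ
  have := isFiniteMeasure_law h
  simp only [propagation_eq h ht (le_max_right _ _), law_max]
  exact neg_le_neg (ENNReal.toReal_mono (measure_ne_top _ _) (antitone_law_Iio h t hστ))

end Law

/-! ### The density of `-w(t, dτ)` and its total mass -/

section Density

variable {k ℓ : ℝ → ℝ}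

/-- A vanishing transform would force `k = 0` almost everywhere, contradicting `k * ℓ = 1`.
Positivity of `φ` is what makes `∫_τ^∞ e^{-σφ} dσ` finite. -/
lemma laplace_pos (h : IsPC k ℓ) {lam : ℝ} (hl : 0 < lam) : 0 < laplace k lam := by
  by_contra hneg
  have h1 := laplaceMeasure_kernelDensity h.locallyIntegrable_k h.antitone_k h.nonneg_k hl
  have hK := measurable_kernelDensity h.antitone_k
  rw [ENNReal.ofReal_eq_zero.2 (not_lt.1 hneg), laplaceMeasure_withDensity hK,
    lintegral_eq_zero_iff (by exact hK.mul (by fun_prop))] at h1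
  have h2 : ∀ᵐ s, (Ioi (0 : ℝ)).indicator k s = 0 := by
    filter_upwards [h1] with s hs
    simp only [Pi.zero_apply, mul_eq_zero, ENNReal.ofReal_eq_zero, not_le.2 (Real.exp_pos _),
      or_false, kernelDensity_eq] at hs
    refine le_antisymm hs (indicator_nonneg (fun t ht => h.nonneg_k t ht) s)
  have h3 : ∀ t, 0 < t → timeConv k ℓ t = 0 := by
    intro t ht
    unfold timeConv
    rw [intervalIntegral.integral_of_le ht.le, integral_Ioc_eq_integral_Ioo]
    refine integral_eq_zero_of_ae ?_
    have h4 := (Measure.measurePreserving_sub_left (volume : Measure ℝ) t).quasiMeasurePreserving.ae h2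
    filter_upwards [ae_restrict_of_ae h4, ae_restrict_mem measurableSet_Ioo] with s hs hs'
    rw [indicator_of_mem (show t - s ∈ Ioi 0 by simpa using hs'.2)] at hs
    simp [hs]
  have hne : (volume.restrict (Ioi (0 : ℝ))) ≠ 0 := by simp
  have : (ae (volume.restrict (Ioi (0 : ℝ)))).NeBot := ae_neBot.2 hne
  obtain ⟨t, ht1, ht2⟩ := (h.conv_eq_one.and (ae_restrict_mem measurableSet_Ioi)).exists
  rw [h3 t ht2] at ht1
  exact zero_ne_one ht1

lemma bernsteinSymbol_pos (h : IsPC k ℓ) {lam : ℝ} (hl : 0 < lam) : 0 < bernsteinSymbol k lam :=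
  mul_pos hl (laplace_pos h hl)

/-- The density of `k * P_σ`, where `P_σ` is the law of the subordinator at time `σ`. -/
noncomputable def convDensity (k : ℝ → ℝ) (t σ : ℝ) : ℝ≥0∞ :=
  ∫⁻ s, kernelDensity k (t - s) ∂(law k σ)

lemma measurable_convDensity (h : IsPC k ℓ) :
    Measurable fun p : ℝ × ℝ => convDensity k p.1 p.2 := by
  have hK := measurable_kernelDensity h.antitone_k
  exact Measurable.lintegral_kernel_prod_right'
    (κ := (lawKernel h).comap Prod.snd measurable_snd)
    (f := fun q : (ℝ × ℝ) × ℝ => kernelDensity k (q.1.1 - q.2)) (by fun_prop)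

lemma measurable_convDensity_right (h : IsPC k ℓ) (t : ℝ) : Measurable (convDensity k t) :=
  (measurable_convDensity h).comp (measurable_prodMk_left (x := t))

lemma lintegral_exp_neg_mul_Ioi {a : ℝ} (ha : 0 < a) {τ : ℝ} :
    ∫⁻ σ in Ioi τ, ENNReal.ofReal (Real.exp (-σ * a)) = ENNReal.ofReal (Real.exp (-τ * a) / a) := by
  have : ∀ σ : ℝ, Real.exp (-σ * a) = Real.exp (-a * σ) := fun σ => by ring_nf
  simp_rw [this]
  rw [← ofReal_integral_eq_lintegral_ofReal (integrableOn_exp_mul_Ioi (by linarith) τ)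
    (ae_of_all _ fun t => (Real.exp_pos _).le), integral_exp_mul_Ioi (by linarith)]
  congr 1
  field_simp

/-- The Laplace transform of the left side is `k̂ ∫_τ^∞ e^{-σφ} dσ = k̂ e^{-τφ}/φ = e^{-τφ}/λ`,
because `φ = λ k̂`. The exceptional null set still depends on `τ`. -/
lemma ae_lintegral_convDensity (h : IsPC k ℓ) {τ : ℝ} (hτ : 0 ≤ τ) :
    ∀ᵐ t, ∫⁻ σ in Ioi τ, convDensity k t σ = law k τ (Iio t) := by
  have hK := measurable_kernelDensity h.antitone_k
  have hc := measurable_convDensity h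
  have hfin := isFiniteMeasure_law h
  have hm : Measurable fun t => ∫⁻ σ in Ioi τ, convDensity k t σ :=
    Measurable.lintegral_prod_right' hc
  have hL : ∀ lam, 0 < lam →
      laplaceMeasure (volume.withDensity fun t => ∫⁻ σ in Ioi τ, convDensity k t σ) lam =
        ENNReal.ofReal (lam⁻¹ * Real.exp (-τ * bernsteinSymbol k lam)) := by
    intro lam hl
    rw [laplaceMeasure_withDensity hm]
    calc ∫⁻ t, (∫⁻ σ in Ioi τ, convDensity k t σ) * ENNReal.ofReal (Real.exp (-lam * t))
        = ∫⁻ t, ∫⁻ σ in Ioi τ, convDensity k t σ * ENNReal.ofReal (Real.exp (-lam * t)) := by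
          refine lintegral_congr fun t => ?_
          rw [lintegral_mul_const _ (measurable_convDensity_right h t)]
      _ = ∫⁻ σ in Ioi τ, ∫⁻ t, convDensity k t σ * ENNReal.ofReal (Real.exp (-lam * t)) := by
          rw [lintegral_lintegral_swap]
          exact (hc.mul (by fun_prop)).aemeasurable
      _ = ∫⁻ σ in Ioi τ, ENNReal.ofReal (laplace k lam) *
            ENNReal.ofReal (Real.exp (-σ * bernsteinSymbol k lam)) := by
          refine setLIntegral_congr_fun measurableSet_Ioi fun σ hσ => ?_
          have hσ0 : 0 ≤ σ := hτ.trans (le_of_lt hσ)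
          have h1 : Measurable fun t => convDensity k t σ := hc.comp measurable_prodMk_right
          rw [← laplaceMeasure_withDensity h1, ← laplaceMeasure_kernelDensity
            h.locallyIntegrable_k h.antitone_k h.nonneg_k hl, ← laplaceMeasure_law h hσ0 hl,
            ← laplaceMeasure_conv, withDensity_conv hK]
          rfl
      _ = _ := by
          rw [lintegral_const_mul _ (by fun_prop), lintegral_exp_neg_mul_Ioi
            (bernsteinSymbol_pos h hl), ← ENNReal.ofReal_mul (laplace_pos h hl).le]
          congr 1
          have := laplace_pos h hl
          rw [div_eq_mul_inv]
          nth_rewrite 2 [bernsteinSymbol]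
          field_simp
  have heq : (volume.withDensity fun t => ∫⁻ σ in Ioi τ, convDensity k t σ) =
      volume.withDensity fun t => law k τ (Iio t) := by
    refine ext_of_laplaceMeasure (fun lam hl => ?_) fun lam hl => ?_
    · rw [hL lam hl]; exact ENNReal.ofReal_ne_top
    · rw [hL lam hl, ← halfLine_conv, laplaceMeasure_conv, laplaceMeasure_halfLine hl,
        laplaceMeasure_law h hτ hl, ← ENNReal.ofReal_mul (by positivity)]
  exact (withDensity_eq_iff_of_sigmaFinite hm.aemeasurable
    (measurable_measure_Iio _).aemeasurable).1 heq

/-- The measure `(k * P_σ)(t) dσ` on `(0, ∞)`. -/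
noncomputable def inverseLaw (k : ℝ → ℝ) (t : ℝ) : Measure ℝ :=
  (volume.restrict (Ioi 0)).withDensity (convDensity k t)

lemma inverseLaw_Ioi (k : ℝ → ℝ) (t : ℝ) {τ : ℝ} (hτ : 0 ≤ τ) :
    inverseLaw k t (Ioi τ) = ∫⁻ σ in Ioi τ, convDensity k t σ := by
  rw [inverseLaw, withDensity_apply _ measurableSet_Ioi, Measure.restrict_restrict
    measurableSet_Ioi, inter_eq_left.2 (Ioi_subset_Ioi hτ)]

lemma tendsto_measure_Ioi_nhdsGT (μ : Measure ℝ) (t : ℝ) :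
    Tendsto (fun s => μ (Ioi s)) (𝓝[>] t) (𝓝 (μ (Ioi t))) := by
  have hm : Antitone fun s => μ (Ioi s) := fun _ _ h => measure_mono (Ioi_subset_Ioi h)
  obtain ⟨u, hu, hlt, hu'⟩ := exists_seq_strictAnti_tendsto t
  have h1 : Tendsto (fun n => μ (Ioi (u n))) atTop (𝓝 (μ (Ioi t))) := by
    have : Ioi t = ⋃ n, Ioi (u n) := by
      ext x
      simp only [mem_Ioi, mem_iUnion]
      exact ⟨fun h => ((tendsto_order.1 hu').2 x h).exists, fun ⟨n, h⟩ => (hlt n).trans h⟩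
    rw [this]
    exact tendsto_measure_iUnion_atTop fun a b h => Ioi_subset_Ioi (hu.antitone h)
  have h2 := hm.tendsto_nhdsGT t
  have h3 := h2.comp (tendsto_nhdsWithin_iff.2 ⟨hu', Eventually.of_forall hlt⟩)
  rwa [tendsto_nhds_unique h3 h1] at h2

lemma tendsto_measure_Ioi_nhdsLT (μ : Measure ℝ) [IsFiniteMeasure μ] [NullSingletonClass μ] (t : ℝ)
    {u : ℕ → ℝ} (hu : StrictMono u) (hlt : ∀ n, u n < t) (hut : Tendsto u atTop (𝓝 t)) :
    Tendsto (fun n => μ (Ioi (u n))) atTop (𝓝 (μ (Ioi t))) := by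
  have h1 : ⋂ n, Ioi (u n) = Ici t := by
    ext x
    simp only [mem_iInter, mem_Ioi, mem_Ici]
    exact ⟨fun h => le_of_tendsto' hut fun n => (h n).le, fun h n => (hlt n).trans_le h⟩
  rw [← measure_congr Ioi_ae_eq_Ici.symm, ← h1]
  exact tendsto_measure_iInter_atTop (fun n => measurableSet_Ioi.nullMeasurableSet)
    (fun a b h => Ioi_subset_Ioi (hu.monotone h)) ⟨0, measure_ne_top _ _⟩

/-- For almost all `t`, `P_τ([0, t)) = ∫_τ^∞ (k * P_σ)(t) dσ` for all `τ ≥ 0`. -/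
lemma ae_inverseLaw_Ioi (h : IsPC k ℓ) : ∀ᵐ t, IsFiniteMeasure (inverseLaw k t) ∧
    ∀ τ, 0 ≤ τ → inverseLaw k t (Ioi τ) = law k τ (Iio t) := by
  -- Rational times share one null set. They suffice because `law k τ (Iio t)` is monotone in `τ`
  -- and `inverseLaw k t` has no atoms, so its tails are continuous.
  have hq : ∀ᵐ t, ∀ q : ℚ, 0 ≤ (q : ℝ) → inverseLaw k t (Ioi (q : ℝ)) = law k q (Iio t) := by
    refine ae_all_iff.2 fun q => ?_
    by_cases hq0 : 0 ≤ (q : ℝ)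
    · filter_upwards [ae_lintegral_convDensity h hq0] with t ht _
      rw [inverseLaw_Ioi k t hq0, ht]
    · exact ae_of_all _ fun t h0 => absurd h0 hq0
  filter_upwards [hq] with t ht
  have ht0 : inverseLaw k t (Ioi 0) = law k 0 (Iio t) := by simpa using ht 0 (by simp)
  have huniv : inverseLaw k t univ = inverseLaw k t (Ioi 0) := by
    rw [inverseLaw, withDensity_apply _ MeasurableSet.univ, withDensity_apply _ measurableSet_Ioi,
      Measure.restrict_univ, Measure.restrict_restrict measurableSet_Ioi, inter_self]
  have hfin : IsFiniteMeasure (inverseLaw k t) := by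
    refine ⟨?_⟩
    rw [huniv, ht0]
    exact ((isSubLaw_law h 0).Iio_le t).trans_lt ENNReal.one_lt_top
  have hna : NullSingletonClass (inverseLaw k t) := by unfold inverseLaw; infer_instance
  refine ⟨hfin, fun τ hτ => le_antisymm ?_ ?_⟩
  · obtain ⟨u, -, hu, hut⟩ :=
      Dense.exists_seq_strictAnti_tendsto (Rat.denseRange_cast (𝕜 := ℝ)) τ
    have hlim : Tendsto u atTop (𝓝[>] τ) :=
      tendsto_nhdsWithin_iff.2 ⟨hut, Eventually.of_forall fun n => (hu n).1⟩
    refine le_of_tendsto' ((tendsto_measure_Ioi_nhdsGT _ τ).comp hlim) fun n => ?_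
    obtain ⟨q, hqu⟩ := (hu n).2
    have h1 : τ < u n := (hu n).1
    rw [Function.comp_apply, ← hqu, ht q (by rw [hqu]; linarith)]
    exact antitone_law_Iio h t (by rw [hqu]; exact h1.le)
  · rcases hτ.eq_or_lt with rfl | hτ'
    · exact ht0.ge
    obtain ⟨u, hum, hu, hut⟩ :=
      Dense.exists_seq_strictMono_tendsto (Rat.denseRange_cast (𝕜 := ℝ)) τ
    refine ge_of_tendsto (tendsto_measure_Ioi_nhdsLT _ τ hum (fun n => (hu n).1) hut) ?_
    filter_upwards [hut.eventually (lt_mem_nhds hτ')] with n hn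
    obtain ⟨q, hqu⟩ := (hu n).2
    have h1 : u n < τ := (hu n).1
    rw [← hqu, ht q (by rw [hqu]; exact hn.le)]
    exact antitone_law_Iio h t (by rw [hqu]; exact h1.le)

lemma propagationMeasure_eq (h : IsPC k ℓ) {t : ℝ} (ht : 0 < t) :
    propagationMeasure k t = (antitone_propagation h ht).stieltjesFunction.measure := by
  rw [propagationMeasure, dif_pos (antitone_propagation h ht)]

lemma tendsto_neg_propagation (h : IsPC k ℓ) {t : ℝ} (ht : 0 < t) {l : Filter ℝ} {c : ℝ≥0∞}
    (hc : c ≠ ∞) (hlim : Tendsto (fun τ => law k τ (Iio t)) l (𝓝 c)) :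
    Tendsto (fun τ => -propagation k t (max τ 0)) l (𝓝 (-c.toReal)) := by
  refine ((ENNReal.tendsto_toReal hc).comp hlim).neg.congr fun τ => ?_
  rw [propagation_eq h ht (le_max_right _ _), law_max]
  rfl

/-- For almost all `t`, the measure `-w(t, dτ)` on `(0, ∞)` has density `k * P_τ`. -/
lemma ae_propagationMeasure_restrict (h : IsPC k ℓ) : ∀ᵐ t, 0 < t →
    (propagationMeasure k t).restrict (Ioi 0) = inverseLaw k t := by
  filter_upwards [ae_inverseLaw_Ioi h] with t ⟨hfin, hI⟩ ht
  have hmono := antitone_propagation h ht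
  rw [propagationMeasure_eq h ht]
  have hS : ∀ τ, 0 ≤ τ → hmono.stieltjesFunction τ = -(inverseLaw k t (Ioi τ)).toReal := by
    intro τ hτ
    rw [hmono.stieltjesFunction_eq]
    refine tendsto_nhds_unique (hmono.tendsto_rightLim τ) ?_
    refine tendsto_neg_propagation h ht (measure_ne_top _ _) ?_
    refine (tendsto_measure_Ioi_nhdsGT _ τ).congr' ?_
    filter_upwards [self_mem_nhdsWithin] with σ hσ
    exact hI σ (hτ.trans (le_of_lt hσ))
  have key : ∀ a b : ℝ, 0 ≤ a → a ≤ b →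
      hmono.stieltjesFunction.measure (Ioc a b) = inverseLaw k t (Ioc a b) := by
    intro a b ha hab
    rw [StieltjesFunction.measure_Ioc, hS a ha, hS b (ha.trans hab), ← Ioi_sdiff_Ioi,
      measure_sdiff (Ioi_subset_Ioi hab) measurableSet_Ioi.nullMeasurableSet (measure_ne_top _ _),
      sub_neg_eq_add, neg_add_eq_sub, ENNReal.ofReal_sub _ ENNReal.toReal_nonneg,
      ENNReal.ofReal_toReal (measure_ne_top _ _), ENNReal.ofReal_toReal (measure_ne_top _ _)]
  refine Measure.ext_of_Ioc _ _ fun a b hab => ?_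
  have h1 : Ioc a b ∩ Ioi 0 = Ioc (max a 0) (max b 0) := by
    ext x
    simp only [mem_inter_iff, mem_Ioc, mem_Ioi, max_lt_iff, le_max_iff]
    constructor
    · rintro ⟨⟨h1, h2⟩, h3⟩; exact ⟨⟨h1, h3⟩, Or.inl h2⟩
    · rintro ⟨⟨h1, h3⟩, h2⟩; exact ⟨⟨h1, h2.resolve_right (not_le.2 h3)⟩, h3⟩
  have h2 : inverseLaw k t (Ioc a b) = inverseLaw k t (Ioc a b ∩ Ioi 0) := by
    rw [inverseLaw, withDensity_apply _ measurableSet_Ioc,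
      withDensity_apply _ (measurableSet_Ioc.inter measurableSet_Ioi),
      Measure.restrict_restrict measurableSet_Ioc,
      Measure.restrict_restrict (measurableSet_Ioc.inter measurableSet_Ioi), inter_assoc, inter_self]
  rw [Measure.restrict_apply measurableSet_Ioc, h2, h1,
    key _ _ (le_max_right _ _) (max_le_max hab.le le_rfl)]

lemma law_zero_Iio (h : IsPC k ℓ) {t : ℝ} (ht : 0 < t) : law k 0 (Iio t) = 1 := by
  rw [law_zero h]; simp [ht]

/-- The density formula is available for almost all times only, but a good `s < t` bounds `P_τ([0,
t))` from below by a quantity tending to one. This gives a statement for every `t > 0`. -/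
lemma tendsto_law_Iio_zero (h : IsPC k ℓ) {t : ℝ} (ht : 0 < t) :
    Tendsto (fun τ => law k τ (Iio t)) (𝓝[>] 0) (𝓝 1) := by
  obtain ⟨s, ⟨hfin, hs⟩, hs0, hst⟩ :=
    (Measure.dense_of_ae (ae_inverseLaw_Ioi h)).exists_between ht
  have h1 : Tendsto (fun τ => inverseLaw k s (Ioi τ)) (𝓝[>] 0) (𝓝 1) := by
    rw [← law_zero_Iio h hs0, ← hs 0 le_rfl]
    exact tendsto_measure_Ioi_nhdsGT _ 0
  refine tendsto_of_tendsto_of_tendsto_of_le_of_le' h1 tendsto_const_nhds ?_ ?_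
  · filter_upwards [self_mem_nhdsWithin] with τ hτ
    rw [hs τ (le_of_lt hτ)]
    exact measure_mono (Iio_subset_Iio hst.le)
  · exact Eventually.of_forall fun τ => (isSubLaw_law h τ).Iio_le t

/-- Here a good `s > t` bounds from above, by the tail of a finite measure. -/
lemma tendsto_law_Iio_atTop (h : IsPC k ℓ) (t : ℝ) :
    Tendsto (fun τ => law k τ (Iio t)) atTop (𝓝 0) := by
  obtain ⟨s, ⟨hfin, hs⟩, hst, -⟩ :=
    (Measure.dense_of_ae (ae_inverseLaw_Ioi h)).exists_between (lt_add_one t)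
  have h1 : Tendsto (fun τ => inverseLaw k s (Ioi τ)) atTop (𝓝 0) := by
    have : ⋂ τ : ℝ, Ioi τ = ∅ := by
      ext x; simp only [mem_iInter, mem_Ioi, mem_empty_iff_false, iff_false, not_forall]
      exact ⟨x, lt_irrefl x⟩
    rw [← measure_empty (μ := inverseLaw k s), ← this]
    exact tendsto_measure_iInter_atTop (fun n => measurableSet_Ioi.nullMeasurableSet)
      (fun a b h => Ioi_subset_Ioi h) ⟨0, measure_ne_top _ _⟩
  refine tendsto_of_tendsto_of_tendsto_of_le_of_le' tendsto_const_nhds h1 ?_ ?_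
  · exact Eventually.of_forall fun τ => bot_le
  · filter_upwards [eventually_ge_atTop 0] with τ hτ
    rw [hs τ hτ]
    exact measure_mono (Iio_subset_Iio hst.le)

/-- For all `t > 0`, the measure `-w(t, dτ)` has mass one on `(0, ∞)`. -/
lemma propagationMeasure_Ioi (h : IsPC k ℓ) {t : ℝ} (ht : 0 < t) :
    propagationMeasure k t (Ioi 0) = 1 := by
  have hmono := antitone_propagation h ht
  rw [propagationMeasure_eq h ht]
  have h0 : hmono.stieltjesFunction 0 = -1 := by
    rw [hmono.stieltjesFunction_eq]
    refine tendsto_nhds_unique (hmono.tendsto_rightLim 0) ?_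
    simpa using tendsto_neg_propagation h ht ENNReal.one_ne_top (tendsto_law_Iio_zero h ht)
  have htop : Tendsto hmono.stieltjesFunction atTop (𝓝 0) := by
    have h1 : Tendsto (fun τ => -propagation k t (max τ 0)) atTop (𝓝 0) := by
      simpa using tendsto_neg_propagation h ht ENNReal.zero_ne_top (tendsto_law_Iio_atTop h t)
    refine tendsto_of_tendsto_of_tendsto_of_le_of_le h1
      (h1.comp (tendsto_atTop_add_const_right atTop 1 tendsto_id)) ?_ ?_
    · intro τ
      exact hmono.le_rightLim le_rfl
    · intro τ
      exact hmono.rightLim_le (lt_add_one τ)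
  rw [StieltjesFunction.measure_Ioi _ htop, h0]
  simp

end Density

/-! ### The potential measure, its density `ℓ`, and cancellation of `k` -/

section Potential

variable {k ℓ : ℝ → ℝ}

/-- The measure `P_τ(ds) dτ` on pairs `(τ, s)`. -/
noncomputable def occupation (h : IsPC k ℓ) : Measure (ℝ × ℝ) := halfLine ⊗ₘ lawKernel h

instance (h : IsPC k ℓ) : SFinite (occupation h) := by unfold occupation; infer_instance

lemma lintegral_occupation (h : IsPC k ℓ) {f : ℝ × ℝ → ℝ≥0∞} (hf : Measurable f) :
    ∫⁻ p, f p ∂(occupation h) = ∫⁻ τ in Ioi 0, ∫⁻ s, f (τ, s) ∂(law k τ) :=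
  Measure.lintegral_compProd hf

/-- The potential measure `∫₀^∞ P_τ dτ` of the subordinator. -/
noncomputable def potential (h : IsPC k ℓ) : Measure ℝ := (occupation h).map Prod.snd

instance (h : IsPC k ℓ) : SFinite (potential h) := by unfold potential; infer_instance

lemma lintegral_potential (h : IsPC k ℓ) {f : ℝ → ℝ≥0∞} (hf : Measurable f) :
    ∫⁻ s, f s ∂(potential h) = ∫⁻ τ in Ioi 0, ∫⁻ s, f s ∂(law k τ) := by
  rw [potential, lintegral_map hf measurable_snd, lintegral_occupation h (by fun_prop)]

lemma potential_apply (h : IsPC k ℓ) {s : Set ℝ} (hs : MeasurableSet s) :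
    potential h s = ∫⁻ τ in Ioi 0, law k τ s := by
  rw [← lintegral_indicator_one hs, lintegral_potential h (measurable_one.indicator hs)]
  simp_rw [lintegral_indicator_one hs]

lemma potential_Iio_zero (h : IsPC k ℓ) : potential h (Iio 0) = 0 := by
  rw [potential_apply h measurableSet_Iio]
  simp [(isSubLaw_law h _).Iio_zero]

lemma laplaceMeasure_potential (h : IsPC k ℓ) {lam : ℝ} (hl : 0 < lam) :
    laplaceMeasure (potential h) lam = ENNReal.ofReal (bernsteinSymbol k lam)⁻¹ := by
  rw [laplaceMeasure, lintegral_potential h (by fun_prop)]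
  have : ∫⁻ τ in Ioi (0 : ℝ), ∫⁻ s, ENNReal.ofReal (Real.exp (-lam * s)) ∂(law k τ) =
      ∫⁻ τ in Ioi (0 : ℝ), ENNReal.ofReal (Real.exp (-τ * bernsteinSymbol k lam)) :=
    setLIntegral_congr_fun measurableSet_Ioi fun τ hτ => laplaceMeasure_law h (le_of_lt hτ) hl
  rw [this, lintegral_exp_neg_mul_Ioi (bernsteinSymbol_pos h hl)]
  simp

lemma measure_Iio_ne_top_of_laplaceMeasure {μ : Measure ℝ} (hμ : laplaceMeasure μ 1 ≠ ∞) (t : ℝ) :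
    μ (Iio t) ≠ ∞ := by
  refine ne_top_of_le_ne_top
    (ENNReal.mul_ne_top (ENNReal.ofReal_ne_top (r := Real.exp t)) hμ) ?_
  rw [← lintegral_indicator_one measurableSet_Iio, laplaceMeasure,
    ← lintegral_const_mul _ (by fun_prop)]
  refine lintegral_mono fun s => ?_
  by_cases hs : s < t
  · rw [indicator_of_mem (show s ∈ Iio t from hs), ← ENNReal.ofReal_mul (Real.exp_pos _).le,
      ← Real.exp_add]
    exact ENNReal.one_le_ofReal.2 (Real.one_le_exp (by linarith))
  · simp [hs]

lemma potential_Iio_ne_top (h : IsPC k ℓ) (t : ℝ) : potential h (Iio t) ≠ ∞ := by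
  refine measure_Iio_ne_top_of_laplaceMeasure ?_ t
  rw [laplaceMeasure_potential h one_pos]
  exact ENNReal.ofReal_ne_top

/-- The kernel `k` as a measure on the half-line. -/
noncomputable def kernelMeasure (k : ℝ → ℝ) : Measure ℝ := volume.withDensity (kernelDensity k)

instance : SFinite (kernelMeasure k) := by unfold kernelMeasure; infer_instance

lemma kernelMeasure_Iio_ne_top (h : IsPC k ℓ) (t : ℝ) : kernelMeasure k (Iio t) ≠ ∞ :=
  measure_Iio_ne_top_of_laplaceMeasure
    (laplaceMeasure_kernelDensity_ne_top h.locallyIntegrable_k h.antitone_k one_pos) t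

lemma kernelMeasure_Iio_zero (k : ℝ → ℝ) : kernelMeasure k (Iio 0) = 0 := by
  rw [kernelMeasure, withDensity_apply _ measurableSet_Iio,
    setLIntegral_congr_fun (g := 0) measurableSet_Iio]
  · simp
  · intro s hs
    exact indicator_of_notMem (fun hs' => lt_asymm hs hs') _

lemma kernelMeasure_conv (h : IsPC k ℓ) (μ : Measure ℝ) [SFinite μ] :
    kernelMeasure k ∗ μ = volume.withDensity fun t => ∫⁻ s, kernelDensity k (t - s) ∂μ :=
  withDensity_conv (measurable_kernelDensity h.antitone_k) μ

lemma measurable_kernelDensity_conv (h : IsPC k ℓ) (μ : Measure ℝ) [SFinite μ] :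
    Measurable fun t => ∫⁻ s, kernelDensity k (t - s) ∂μ := by
  have := measurable_kernelDensity h.antitone_k
  exact Measurable.lintegral_prod_right'
    (f := fun p : ℝ × ℝ => kernelDensity k (p.1 - p.2)) (by fun_prop)

/-- The potential measure inverts convolution with `k`. -/
lemma kernelMeasure_conv_potential (h : IsPC k ℓ) : kernelMeasure k ∗ potential h = halfLine := by
  have hK := measurable_kernelDensity h.antitone_k
  rw [kernelMeasure_conv h, halfLine_eq_withDensity]
  refine withDensity_congr_ae ?_
  filter_upwards [ae_lintegral_convDensity h le_rfl] with t ht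
  rw [lintegral_potential h (by fun_prop)]
  refine ht.trans ?_
  by_cases h0 : 0 < t
  · simp [law_zero_Iio h h0, h0]
  · rw [(isSubLaw_law h 0).Iio_of_nonpos (not_lt.1 h0)]
    simp [h0]

/-- Convolution with `k` is injective on locally finite measures. -/
lemma kernelMeasure_conv_injective (h : IsPC k ℓ) {μ ν : Measure ℝ} [SFinite μ] [SFinite ν]
    (hμ : ∀ t, μ (Iio t) ≠ ∞) (heq : kernelMeasure k ∗ μ = kernelMeasure k ∗ ν) : μ = ν := by
  -- Convolution with the potential turns `k` into Lebesgue measure on the half-line, leaving the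
  -- distribution function of `m`.
  have key : ∀ (m : Measure ℝ) [SFinite m],
      potential h ∗ (kernelMeasure k ∗ m) = volume.withDensity fun t => m (Iio t) := by
    intro m _
    rw [← Measure.conv_assoc, Measure.conv_comm (potential h), kernelMeasure_conv_potential,
      halfLine_conv]
  have h1 : (volume.withDensity fun t => μ (Iio t)) = volume.withDensity fun t => ν (Iio t) := by
    rw [← key μ, ← key ν, heq]
  exact ext_of_ae_Iio hμ ((withDensity_eq_iff_of_sigmaFinite
    (measurable_measure_Iio _).aemeasurable (measurable_measure_Iio _).aemeasurable).1 h1)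

/-- The measure `f⁺(t) dt` on the positive half-line. -/
noncomputable def posPartMeasure (f : ℝ → ℝ) : Measure ℝ :=
  halfLine.withDensity fun t => ENNReal.ofReal (f t)

instance (f : ℝ → ℝ) : SFinite (posPartMeasure f) := by unfold posPartMeasure; infer_instance

lemma posPartMeasure_Iio_zero (f : ℝ → ℝ) : posPartMeasure f (Iio 0) = 0 := by
  rw [posPartMeasure, withDensity_apply _ measurableSet_Iio, halfLine,
    Measure.restrict_restrict measurableSet_Iio]
  have : Iio (0 : ℝ) ∩ Ioi 0 = ∅ := by
    ext x; simp only [mem_inter_iff, mem_Iio, mem_Ioi, mem_empty_iff_false, iff_false, not_and]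
    exact fun h => lt_asymm h
  simp [this]

lemma posPartMeasure_Iio_ne_top {f : ℝ → ℝ} (hf : LocallyIntegrableOn f (Ici 0)) (t : ℝ) :
    posPartMeasure f (Iio t) ≠ ∞ := by
  rw [posPartMeasure, withDensity_apply _ measurableSet_Iio, halfLine,
    Measure.restrict_restrict measurableSet_Iio]
  have : IntegrableOn f (Iio t ∩ Ioi 0) := (hf.integrableOn_compact_subset
    (fun x hx => hx.1) (isCompact_Icc (a := 0) (b := t))).mono_set
      fun x hx => ⟨le_of_lt hx.2, le_of_lt hx.1⟩
  exact this.lintegral_lt_top.ne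

lemma aemeasurable_of_locallyIntegrableOn {f : ℝ → ℝ} (hf : LocallyIntegrableOn f (Ici 0)) :
    AEMeasurable f halfLine :=
  (hf.mono_set Ioi_subset_Ici_self).aestronglyMeasurable.aemeasurable

/-- This is the density of a convolution that has finite mass on each `Iio n`. -/
lemma ae_kernelDensity_conv_lt_top (h : IsPC k ℓ) {μ : Measure ℝ} [SFinite μ]
    (hμ0 : μ (Iio 0) = 0) (hμ : ∀ t, μ (Iio t) ≠ ∞) :
    ∀ᵐ t, ∫⁻ s, kernelDensity k (t - s) ∂μ < ∞ := by
  have h1 : ∀ n : ℕ, ∀ᵐ t ∂(volume.restrict (Iio (n : ℝ))),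
      ∫⁻ s, kernelDensity k (t - s) ∂μ < ∞ := by
    intro n
    refine ae_lt_top (measurable_kernelDensity_conv h μ) ?_
    rw [← withDensity_apply _ measurableSet_Iio, ← kernelMeasure_conv h]
    exact ne_top_of_le_ne_top (ENNReal.mul_ne_top (kernelMeasure_Iio_ne_top h n) (hμ n))
      (conv_Iio_le_mul (kernelMeasure_Iio_zero k) hμ0 n)
  have h2 : (⋃ n : ℕ, Iio (n : ℝ)) = univ :=
    eq_univ_of_forall fun x => mem_iUnion.2 (exists_nat_gt x)
  have h3 := (ae_restrict_iUnion_iff (μ := volume) (fun n : ℕ => Iio (n : ℝ)) _).2 h1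
  rwa [h2, Measure.restrict_univ] at h3

lemma timeConv_comm (f g : ℝ → ℝ) (t : ℝ) : timeConv f g t = timeConv g f t := by
  unfold timeConv
  have := intervalIntegral.integral_comp_sub_left (a := 0) (b := t) (fun s => f (t - s) * g s) t
  rw [sub_self, sub_zero] at this
  rw [← this]
  simp [mul_comm]

lemma lintegral_kernelDensity_posPartMeasure (h : IsPC k ℓ) {f : ℝ → ℝ}
    (hf : AEMeasurable f halfLine) (t : ℝ) :
    ∫⁻ s, kernelDensity k (t - s) ∂(posPartMeasure f) =
      ∫⁻ s in Ioo 0 t, ENNReal.ofReal (k (t - s) * f s) := by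
  have hK := measurable_kernelDensity h.antitone_k
  rw [posPartMeasure, lintegral_withDensity_eq_lintegral_mul₀ hf.ennreal_ofReal (by fun_prop),
    halfLine, ← lintegral_indicator measurableSet_Ioi, ← lintegral_indicator measurableSet_Ioo]
  refine lintegral_congr fun s => ?_
  by_cases hs : 0 < s
  · rw [indicator_of_mem (show s ∈ Ioi 0 from hs)]
    by_cases hst : s < t
    · rw [indicator_of_mem (show s ∈ Ioo 0 t from ⟨hs, hst⟩), Pi.mul_apply, kernelDensity,
        indicator_of_mem (show t - s ∈ Ioi 0 by simpa using hst), mul_comm,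
        ENNReal.ofReal_mul (h.nonneg_k _ (by linarith))]
    · rw [indicator_of_notMem (fun hs' => hst hs'.2), Pi.mul_apply, kernelDensity,
        indicator_of_notMem (show t - s ∉ Ioi 0 by simpa using hst), mul_zero]
  · rw [indicator_of_notMem (show s ∉ Ioi 0 from hs), indicator_of_notMem (fun hs' => hs hs'.1)]

/-- The Bochner integral in `timeConv` defaults to zero without integrability; finiteness of both
parts excludes this and gives `k * f = k * f⁺ - k * f⁻`. -/
lemma timeConv_eq_sub (h : IsPC k ℓ) {f : ℝ → ℝ} (hf : AEMeasurable f halfLine) {t : ℝ}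
    (ht : 0 < t) (h1 : ∫⁻ s, kernelDensity k (t - s) ∂(posPartMeasure f) < ∞)
    (h2 : ∫⁻ s, kernelDensity k (t - s) ∂(posPartMeasure fun s => -f s) < ∞) :
    timeConv k f t = (∫⁻ s, kernelDensity k (t - s) ∂(posPartMeasure f)).toReal -
      (∫⁻ s, kernelDensity k (t - s) ∂(posPartMeasure fun s => -f s)).toReal := by
  rw [lintegral_kernelDensity_posPartMeasure h hf] at h1 ⊢
  rw [lintegral_kernelDensity_posPartMeasure h (f := fun s => -f s) hf.neg] at h2 ⊢
  unfold timeConv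
  rw [intervalIntegral.integral_of_le ht.le, integral_Ioc_eq_integral_Ioo]
  have hmeas : AEStronglyMeasurable (fun s => k (t - s) * f s) (volume.restrict (Ioo 0 t)) := by
    have h3 : AEMeasurable f (volume.restrict (Ioo 0 t)) :=
      hf.mono_measure (Measure.restrict_mono_set _ fun s hs => hs.1)
    have h4 : AEMeasurable (fun s => k (t - s)) (volume.restrict (Ioo 0 t)) := by
      refine ((measurable_indicator_of_antitoneOn h.antitone_k).comp
        (measurable_const_sub t)).aemeasurable.congr ?_
      filter_upwards [ae_restrict_mem measurableSet_Ioo] with s hs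
      exact indicator_of_mem (show t - s ∈ Ioi 0 by simpa using hs.2) _
    exact (h4.mul h3).aestronglyMeasurable
  have h_int : Integrable (fun s => k (t - s) * f s) (volume.restrict (Ioo 0 t)) := by
    refine ⟨hmeas, ?_⟩
    rw [hasFiniteIntegral_iff_norm]
    refine lt_of_le_of_lt ?_ (ENNReal.add_lt_top.2 ⟨h1, h2⟩)
    rw [← lintegral_add_left' hmeas.aemeasurable.ennreal_ofReal]
    refine lintegral_mono fun s => ?_
    rw [Real.norm_eq_abs, mul_neg]
    rcases abs_cases (k (t - s) * f s) with hc | hc <;> rw [hc.1]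
    · exact le_self_add
    · exact le_add_self
  rw [integral_eq_lintegral_pos_part_sub_lintegral_neg_part h_int]
  simp

/-- A locally integrable function whose convolution with `k` agrees with that of a locally finite
measure is almost everywhere nonnegative, and it is the density of that measure. -/
theorem nonneg_and_posPartMeasure_eq (h : IsPC k ℓ) {f : ℝ → ℝ}
    (hf : LocallyIntegrableOn f (Ici 0)) {ν : Measure ℝ} [SFinite ν] (hν0 : ν (Iio 0) = 0)
    (hν : ∀ t, ν (Iio t) ≠ ∞) (hconv : ∀ᵐ t ∂halfLine,
      timeConv k f t = (∫⁻ s, kernelDensity k (t - s) ∂ν).toReal) :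
    (∀ᵐ t ∂halfLine, 0 ≤ f t) ∧ posPartMeasure f = ν := by
  have hfm := aemeasurable_of_locallyIntegrableOn hf
  -- The signed equation `k * f = k * ν` is rearranged as `k * f⁺ = k * (ν + f⁻)`, between positive
  -- measures, where `k` can be cancelled.
  have hsum : posPartMeasure f = ν + posPartMeasure fun t => -f t := by
    refine kernelMeasure_conv_injective h (posPartMeasure_Iio_ne_top hf) ?_
    rw [kernelMeasure_conv h, kernelMeasure_conv h]
    refine withDensity_congr_ae ?_
    have hc := (ae_restrict_iff' measurableSet_Ioi).1 hconv
    filter_upwards [hc,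
      ae_kernelDensity_conv_lt_top h (posPartMeasure_Iio_zero f) (posPartMeasure_Iio_ne_top hf),
      ae_kernelDensity_conv_lt_top h (posPartMeasure_Iio_zero fun t => -f t)
        (posPartMeasure_Iio_ne_top hf.neg), ae_kernelDensity_conv_lt_top h hν0 hν]
      with t h1 h2 h3 h4
    rw [lintegral_add_measure]
    by_cases ht : 0 < t
    · have h5 := h1 ht
      rw [timeConv_eq_sub h hfm ht h2 h3] at h5
      rw [← ENNReal.toReal_eq_toReal_iff' h2.ne (ENNReal.add_ne_top.2 ⟨h4.ne, h3.ne⟩),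
        ENNReal.toReal_add h4.ne h3.ne]
      linarith
    · have hz : ∀ m : Measure ℝ, m (Iio 0) = 0 → ∫⁻ s, kernelDensity k (t - s) ∂m = 0 := by
        intro m hm
        refine lintegral_eq_zero_of_ae_eq_zero ?_
        filter_upwards [measure_eq_zero_iff_ae_notMem.1 hm] with s hs
        simp only [mem_Iio, not_lt] at hs
        exact indicator_of_notMem (show t - s ∉ Ioi 0 by simp only [mem_Ioi]; linarith) _
      rw [hz _ (posPartMeasure_Iio_zero f), hz _ hν0, hz _ (posPartMeasure_Iio_zero fun t => -f t),
        add_zero]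
  have hpos : ∀ᵐ t ∂halfLine, 0 ≤ f t := by
    have : SigmaFinite halfLine := by unfold halfLine; infer_instance
    -- Since `ν ≥ 0`, this gives `f⁻ ≤ f⁺`; the two are never both nonzero at a point, so `f⁻ = 0`.
    have h1 : (fun t => ENNReal.ofReal (-f t)) ≤ᵐ[halfLine] fun t => ENNReal.ofReal (f t) := by
      refine ae_le_of_forall_setLIntegral_le_of_sigmaFinite₀ hfm.neg.ennreal_ofReal ?_
      intro s hs _
      rw [← withDensity_apply _ hs, ← withDensity_apply _ hs]
      change posPartMeasure (fun t => -f t) s ≤ posPartMeasure f s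
      rw [hsum, Measure.add_apply]
      exact le_add_self
    filter_upwards [h1] with t ht
    by_contra hneg
    push Not at hneg
    rw [ENNReal.ofReal_of_nonpos hneg.le] at ht
    have := ENNReal.ofReal_eq_zero.1 (le_antisymm ht bot_le)
    linarith
  refine ⟨hpos, ?_⟩
  have h0 : posPartMeasure (fun t => -f t) = 0 := by
    have : posPartMeasure (fun t => -f t) = halfLine.withDensity 0 := by
      refine withDensity_congr_ae ?_
      filter_upwards [hpos] with t ht
      simpa using ht
    rw [this, withDensity_zero]
  rw [hsum, h0, add_zero]

lemma ae_kernelDensity_conv_potential (h : IsPC k ℓ) :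
    ∀ᵐ t ∂halfLine, ∫⁻ s, kernelDensity k (t - s) ∂(potential h) = 1 := by
  have hK := measurable_kernelDensity h.antitone_k
  filter_upwards [ae_restrict_of_ae (ae_lintegral_convDensity h le_rfl),
    ae_restrict_mem measurableSet_Ioi] with t ht ht0
  rw [lintegral_potential h (by fun_prop), ← law_zero_Iio h ht0]
  exact ht

/-- The kernel `ℓ` is almost everywhere nonnegative, and it is the potential density. -/
lemma nonneg_and_posPartMeasure_l (h : IsPC k ℓ) :
    (∀ᵐ t ∂halfLine, 0 ≤ ℓ t) ∧ posPartMeasure ℓ = potential h := by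
  refine nonneg_and_posPartMeasure_eq h h.locallyIntegrable_l (potential_Iio_zero h)
    (potential_Iio_ne_top h) ?_
  filter_upwards [h.conv_eq_one, ae_kernelDensity_conv_potential h] with t h1 h2
  rw [h1, h2, ENNReal.toReal_one]

/-- This is where the existence of `ℓ` as a function enters the construction of `Y`. -/
lemma potential_absolutelyContinuous (h : IsPC k ℓ) : potential h ≪ volume := by
  rw [← (nonneg_and_posPartMeasure_l h).2]
  exact (withDensity_absolutelyContinuous _ _).trans Measure.absolutelyContinuous_restrict

end Potential

/-! ### Explicit Gaussian and Cauchy densities -/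

lemma stableDensity_gauss (d : ℕ) {τ : ℝ} (hτ : 0 < τ) (x : EuclideanSpace ℝ (Fin d)) :
    stableDensity d 2 τ x = ((2 * Real.pi) ^ d)⁻¹ *
      ((Real.pi / τ) ^ ((d : ℝ) / 2) * Real.exp (-(4 * τ)⁻¹ * ‖x‖ ^ 2)) := by
  unfold stableDensity
  have h1 : ∀ ξ : EuclideanSpace ℝ (Fin d),
      Complex.exp (Complex.I * (inner ℝ x ξ : ℝ)) * (Real.exp (-τ * ‖ξ‖ ^ (2 : ℝ)) : ℂ) =
        Complex.exp (-(τ : ℂ) * ‖ξ‖ ^ 2 + Complex.I * (inner ℝ x ξ : ℝ)) := by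
    intro ξ
    rw [Real.rpow_two, Complex.ofReal_exp, ← Complex.exp_add]
    push_cast
    ring_nf
  simp_rw [h1]
  rw [GaussianFourier.integral_cexp_neg_mul_sq_norm_add (by simpa using hτ), finrank_euclideanSpace,
    Fintype.card_fin]
  have h2 : ((Real.pi : ℂ) / (τ : ℂ)) ^ ((d : ℂ) / 2) *
      Complex.exp (Complex.I ^ 2 * (‖x‖ : ℂ) ^ 2 / (4 * (τ : ℂ))) =
      (((Real.pi / τ) ^ ((d : ℝ) / 2) * Real.exp (-(4 * τ)⁻¹ * ‖x‖ ^ 2) : ℝ) : ℂ) := by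
    rw [Complex.ofReal_mul, Complex.ofReal_cpow (by positivity), Complex.ofReal_exp, Complex.I_sq]
    push_cast
    congr 2
    field_simp
  rw [h2, Complex.ofReal_re]

lemma integral_gauss (d : ℕ) {τ : ℝ} (hτ : 0 < τ) :
    ∫ x : EuclideanSpace ℝ (Fin d), ((2 * Real.pi) ^ d)⁻¹ *
      ((Real.pi / τ) ^ ((d : ℝ) / 2) * Real.exp (-(4 * τ)⁻¹ * ‖x‖ ^ 2)) = 1 := by
  have hpi := Real.pi_pos
  rw [integral_const_mul, integral_const_mul,
    GaussianFourier.integral_rexp_neg_mul_sq_norm (by positivity), finrank_euclideanSpace,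
    Fintype.card_fin, ← Real.mul_rpow (by positivity) (by positivity)]
  have h1 : Real.pi / τ * (Real.pi / (4 * τ)⁻¹) = (2 * Real.pi) ^ (2 : ℝ) := by
    rw [Real.rpow_two]; field_simp; ring
  rw [h1, ← Real.rpow_mul (by positivity), mul_div_cancel₀ _ (two_ne_zero), Real.rpow_natCast,
    inv_mul_cancel₀ (by positivity)]

/-- Splitting at `0` leaves two exponentials with rates `a = τ + iy` and `b = -τ + iy`; the integral
is `1/a - 1/b`. -/
lemma integral_exp_mul_exp_abs {τ : ℝ} (hτ : 0 < τ) (y : ℝ) :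
    ∫ r : ℝ, Complex.exp (Complex.I * (r * y : ℝ)) * (Real.exp (-τ * |r|) : ℂ) =
      ((2 * τ / (τ ^ 2 + y ^ 2) : ℝ) : ℂ) := by
  set a : ℂ := τ + Complex.I * y with ha
  set b : ℂ := -τ + Complex.I * y with hb
  have hare : 0 < a.re := by simpa [ha] using hτ
  have hbre : b.re < 0 := by simpa [hb] using hτ
  have e1 : EqOn (fun r : ℝ => Complex.exp (a * r))
      (fun r : ℝ => Complex.exp (Complex.I * (r * y : ℝ)) * (Real.exp (-τ * |r|) : ℂ)) (Iic 0) := by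
    intro r hr
    simp only
    rw [abs_of_nonpos hr, Complex.ofReal_exp, ← Complex.exp_add, ha]
    push_cast
    ring_nf
  have e2 : EqOn (fun r : ℝ => Complex.exp (b * r))
      (fun r : ℝ => Complex.exp (Complex.I * (r * y : ℝ)) * (Real.exp (-τ * |r|) : ℂ)) (Ioi 0) := by
    intro r hr
    simp only
    rw [abs_of_pos hr, Complex.ofReal_exp, ← Complex.exp_add, hb]
    push_cast
    ring_nf
  rw [← intervalIntegral.integral_Iic_add_Ioi (b := 0)
      ((integrableOn_exp_mul_complex_Iic hare 0).congr_fun e1 measurableSet_Iic)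
      ((integrableOn_exp_mul_complex_Ioi hbre 0).congr_fun e2 measurableSet_Ioi),
    ← setIntegral_congr_fun measurableSet_Iic e1, ← setIntegral_congr_fun measurableSet_Ioi e2,
    integral_exp_mul_complex_Iic hare, integral_exp_mul_complex_Ioi hbre]
  have ha0 : a ≠ 0 := fun h => by rw [h] at hare; simp at hare
  have hb0 : b ≠ 0 := fun h => by rw [h] at hbre; simp at hbre
  have hab : a * b = -((τ ^ 2 + y ^ 2 : ℝ) : ℂ) := by
    rw [ha, hb]
    push_cast
    linear_combination (y : ℂ) ^ 2 * Complex.I_sq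
  have hc0 : ((τ ^ 2 + y ^ 2 : ℝ) : ℂ) ≠ 0 := Complex.ofReal_ne_zero.2 (by positivity)
  simp only [Complex.ofReal_zero, mul_zero, Complex.exp_zero]
  rw [Complex.ofReal_div, div_add_div _ _ ha0 hb0, hab, div_eq_div_iff (neg_ne_zero.2 hc0) hc0]
  rw [ha, hb]
  push_cast
  ring

lemma nonempty_linearIsometryEquiv_fin_one : Nonempty (ℝ ≃ₗᵢ[ℝ] EuclideanSpace ℝ (Fin 1)) :=
  ⟨(OrthonormalBasis.singleton (Fin 1) ℝ).repr⟩

lemma stableDensity_cauchy {τ : ℝ} (hτ : 0 < τ) (x : EuclideanSpace ℝ (Fin 1)) :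
    stableDensity 1 1 τ x = Real.pi⁻¹ * (τ / (τ ^ 2 + ‖x‖ ^ 2)) := by
  obtain ⟨e⟩ := nonempty_linearIsometryEquiv_fin_one
  obtain ⟨y, rfl⟩ := e.surjective x
  unfold stableDensity
  rw [← e.measurePreserving.integral_comp e.toHomeomorph.measurableEmbedding]
  simp only [LinearIsometryEquiv.inner_map_map, LinearIsometryEquiv.norm_map, Real.rpow_one,
    Real.norm_eq_abs, sq_abs]
  have : ∀ r : ℝ, inner ℝ y r = r * y := fun r => by simp
  simp_rw [this]
  rw [integral_exp_mul_exp_abs hτ, Complex.ofReal_re]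
  have := Real.pi_pos
  field_simp

lemma integral_cauchy {τ : ℝ} (hτ : 0 < τ) :
    ∫ x : EuclideanSpace ℝ (Fin 1), Real.pi⁻¹ * (τ / (τ ^ 2 + ‖x‖ ^ 2)) = 1 := by
  obtain ⟨e⟩ := nonempty_linearIsometryEquiv_fin_one
  rw [← e.measurePreserving.integral_comp e.toHomeomorph.measurableEmbedding]
  simp only [LinearIsometryEquiv.norm_map, Real.norm_eq_abs, sq_abs]
  rw [integral_const_mul]
  have h1 : ∀ r : ℝ, τ / (τ ^ 2 + r ^ 2) = τ⁻¹ * (1 + (r / τ) ^ 2)⁻¹ := fun r => by field_simp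
  simp_rw [h1]
  rw [integral_const_mul, Measure.integral_comp_div (fun u : ℝ => (1 + u ^ 2)⁻¹) τ,
    integral_univ_inv_one_add_sq, abs_of_pos hτ, smul_eq_mul]
  have := Real.pi_pos
  field_simp

/-- The densities of the Gaussian and Cauchy semigroups are jointly measurable probability
densities. -/
lemma exists_stableDensity {d : ℕ} {ρ : ℝ} (hρ : ρ = 2 ∨ (ρ = 1 ∧ d = 1)) :
    ∃ g : ℝ × EuclideanSpace ℝ (Fin d) → ℝ≥0∞, Measurable g ∧ ∀ τ, 0 < τ →
      (∀ x, 0 ≤ stableDensity d ρ τ x) ∧ (∀ x, g (τ, x) = ENNReal.ofReal (stableDensity d ρ τ x)) ∧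
        ∫⁻ x, g (τ, x) = 1 := by
  have hpi := Real.pi_pos
  suffices ∃ g : ℝ × EuclideanSpace ℝ (Fin d) → ℝ, Measurable g ∧ ∀ τ, 0 < τ →
      (∀ x, stableDensity d ρ τ x = g (τ, x)) ∧ (∀ x, 0 ≤ g (τ, x)) ∧ ∫ x, g (τ, x) = 1 by
    obtain ⟨g, hg, h⟩ := this
    refine ⟨fun p => ENNReal.ofReal (g p), hg.ennreal_ofReal, fun τ hτ => ?_⟩
    obtain ⟨h1, h2, h3⟩ := h τ hτ
    refine ⟨fun x => h1 x ▸ h2 x, fun x => by rw [h1 x], ?_⟩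
    have h_int : Integrable fun x => g (τ, x) := by
      by_contra hni
      rw [integral_undef hni] at h3
      exact zero_ne_one h3
    rw [← ofReal_integral_eq_lintegral_ofReal h_int (ae_of_all _ h2), h3, ENNReal.ofReal_one]
  rcases hρ with rfl | ⟨rfl, rfl⟩
  · refine ⟨fun p => ((2 * Real.pi) ^ d)⁻¹ *
      ((Real.pi / p.1) ^ ((d : ℝ) / 2) * Real.exp (-(4 * p.1)⁻¹ * ‖p.2‖ ^ 2)), by fun_prop,
      fun τ hτ => ⟨fun x => stableDensity_gauss d hτ x, fun x => by positivity,
        integral_gauss d hτ⟩⟩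
  · exact ⟨fun p => Real.pi⁻¹ * (p.1 / (p.1 ^ 2 + ‖p.2‖ ^ 2)), by fun_prop,
      fun τ hτ => ⟨fun x => stableDensity_cauchy hτ x, fun x => by positivity,
        integral_cauchy hτ⟩⟩

/-! ### The space-time measure and its density `Y` -/

section Joint

variable {k ℓ : ℝ → ℝ} {E : Type*} [MeasureSpace E] {g : ℝ × E → ℝ≥0∞}

/-- The measure `∫₀^∞ P_τ(ds) g(τ, x) dx dτ` on pairs `(s, x)`. -/
noncomputable def jointMeasure (h : IsPC k ℓ) (g : ℝ × E → ℝ≥0∞) : Measure (ℝ × E) :=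
  (((occupation h).prod volume).withDensity fun p => g (p.1.1, p.2)).map fun p => (p.1.2, p.2)

/-- The density of the measure `∫₀^∞ P_τ(ds) g(τ, x) dx dτ`. -/
noncomputable def jointDensity (h : IsPC k ℓ) (g : ℝ × E → ℝ≥0∞) : ℝ × E → ℝ≥0∞ :=
  (jointMeasure h g).rnDeriv ((volume : Measure ℝ).prod volume)

lemma measurable_jointDensity (h : IsPC k ℓ) (g : ℝ × E → ℝ≥0∞) :
    Measurable (jointDensity h g) := Measure.measurable_rnDeriv _ _

/-- The measure `Y(t, x) dt` for the density `Y` of the joint measure. -/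
noncomputable def sectionMeasure (h : IsPC k ℓ) (g : ℝ × E → ℝ≥0∞) (x : E) : Measure ℝ :=
  volume.withDensity fun t => jointDensity h g (t, x)

instance (h : IsPC k ℓ) (g : ℝ × E → ℝ≥0∞) (x : E) : SFinite (sectionMeasure h g x) := by
  unfold sectionMeasure; infer_instance

/-- The candidate solution, the real-valued density of the joint measure. -/
noncomputable def solution (h : IsPC k ℓ) (g : ℝ × E → ℝ≥0∞) (t : ℝ) (x : E) : ℝ :=
  (jointDensity h g (t, x)).toReal

lemma measurable_solution (h : IsPC k ℓ) (g : ℝ × E → ℝ≥0∞) :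
    Measurable (Function.uncurry (solution h g)) :=
  (measurable_jointDensity h g).ennreal_toReal

lemma locallyIntegrableOn_solution (h : IsPC k ℓ) {x : E}
    (hx : ∀ t, sectionMeasure h g x (Iio t) ≠ ∞) :
    LocallyIntegrableOn (fun t => solution h g t x) (Ici 0) := by
  have hm := measurable_jointDensity h g
  intro t _
  refine ⟨Iio (t + 1), mem_nhdsWithin_of_mem_nhds (Iio_mem_nhds (lt_add_one t)), ?_⟩
  have h1 := hx (t + 1)
  rw [sectionMeasure, withDensity_apply _ measurableSet_Iio] at h1
  exact integrable_toReal_of_lintegral_ne_top (by fun_prop) h1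

/-- Passing to real values loses nothing: local finiteness makes the density finite almost
everywhere. -/
lemma posPartMeasure_solution (h : IsPC k ℓ) {x : E} (hx0 : sectionMeasure h g x (Iio 0) = 0)
    (hx : ∀ t, sectionMeasure h g x (Iio t) ≠ ∞) :
    posPartMeasure (fun t => solution h g t x) = sectionMeasure h g x := by
  have hm := measurable_jointDensity h g
  have hxm : Measurable fun t => jointDensity h g (t, x) := by fun_prop
  have hfin : ∀ᵐ t, jointDensity h g (t, x) < ∞ := by
    have h1 : ∀ n : ℕ, ∀ᵐ t ∂(volume.restrict (Iio (n : ℝ))), jointDensity h g (t, x) < ∞ := by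
      intro n
      refine ae_lt_top hxm ?_
      rw [← withDensity_apply _ measurableSet_Iio]
      exact hx n
    have h2 : (⋃ n : ℕ, Iio (n : ℝ)) = univ :=
      eq_univ_of_forall fun x => mem_iUnion.2 (exists_nat_gt x)
    have h3 := (ae_restrict_iUnion_iff (μ := volume) (fun n : ℕ => Iio (n : ℝ)) _).2 h1
    rwa [h2, Measure.restrict_univ] at h3
  have h1 : posPartMeasure (fun t => solution h g t x) =
      (sectionMeasure h g x).restrict (Ioi 0) := by
    rw [sectionMeasure, restrict_withDensity measurableSet_Ioi]
    refine withDensity_congr_ae ?_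
    filter_upwards [ae_restrict_of_ae hfin] with t ht
    exact ENNReal.ofReal_toReal ht.ne
  rw [h1]
  refine Measure.restrict_eq_self_of_ae_mem ?_
  have h2 : sectionMeasure h g x {0} = 0 :=
    withDensity_absolutelyContinuous _ _ (measure_singleton 0)
  filter_upwards [measure_eq_zero_iff_ae_notMem.1 hx0, measure_eq_zero_iff_ae_notMem.1 h2]
    with t ht1 ht2
  exact lt_of_le_of_ne (not_lt.1 ht1) (Ne.symm ht2)

lemma measurable_sectionMeasure_Iio (h : IsPC k ℓ) (g : ℝ × E → ℝ≥0∞) (t : ℝ) :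
    Measurable fun x => sectionMeasure h g x (Iio t) := by
  simp only [sectionMeasure, withDensity_apply _ measurableSet_Iio]
  exact (measurable_jointDensity h g).lintegral_prod_left'

/-- The subordinated density `∫₀^∞ g(τ, x) (k * P_τ)(t) dτ`. -/
noncomputable def subordinated (h : IsPC k ℓ) (g : ℝ × E → ℝ≥0∞) (t : ℝ) (x : E) : ℝ≥0∞ :=
  ∫⁻ p, g (p.1, x) * kernelDensity k (t - p.2) ∂(occupation h)

/-- For almost all `t`, integration against `-w(t, dτ)` is given by the subordinated density. -/
lemma ae_lintegral_propagationMeasure (h : IsPC k ℓ) (hg : Measurable g) :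
    ∀ᵐ t ∂halfLine, ∀ x : E,
      ∫⁻ τ in Ioi 0, g (τ, x) ∂(propagationMeasure k t) = subordinated h g t x := by
  have hK := measurable_kernelDensity h.antitone_k
  filter_upwards [ae_restrict_of_ae (ae_propagationMeasure_restrict h),
    ae_restrict_mem measurableSet_Ioi] with t ht ht0 x
  rw [ht ht0, inverseLaw, lintegral_withDensity_eq_lintegral_mul _
    (measurable_convDensity_right h t) (by fun_prop), subordinated,
    lintegral_occupation h (by fun_prop)]
  refine lintegral_congr fun τ => ?_
  simp only [Pi.mul_apply]
  rw [lintegral_const_mul _ (by fun_prop), mul_comm]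
  rfl

variable [SigmaFinite (volume : Measure E)]

instance (h : IsPC k ℓ) (g : ℝ × E → ℝ≥0∞) : SFinite (jointMeasure h g) := by
  unfold jointMeasure; infer_instance

lemma lintegral_jointMeasure (h : IsPC k ℓ) (hg : Measurable g) {F : ℝ × E → ℝ≥0∞}
    (hF : Measurable F) : ∫⁻ q, F q ∂(jointMeasure h g) =
      ∫⁻ p, (∫⁻ x, g (p.1, x) * F (p.2, x)) ∂(occupation h) := by
  rw [jointMeasure, lintegral_map hF (by fun_prop),
    lintegral_withDensity_eq_lintegral_mul _ (by fun_prop) (by fun_prop),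
    lintegral_prod _ (by fun_prop)]
  rfl

/-- A null set has null sections at almost every time `s`, hence at potential-almost every `s`, and
`g(τ, x) dx` does not charge them. The Radon–Nikodym derivative thus carries the whole measure. -/
lemma jointMeasure_absolutelyContinuous (h : IsPC k ℓ) (hg : Measurable g) :
    jointMeasure h g ≪ (volume : Measure ℝ).prod (volume : Measure E) := by
  refine Measure.AbsolutelyContinuous.mk fun N hN h0 => ?_
  rw [← lintegral_indicator_one hN,
    lintegral_jointMeasure h hg (measurable_one.indicator hN)]
  have h1 : ∀ᵐ s, volume (Prod.mk s ⁻¹' N) = 0 := Measure.measure_ae_null_of_prod_null h0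
  have h2 : ∀ᵐ p ∂(occupation h), volume (Prod.mk p.2 ⁻¹' N) = 0 :=
    ae_of_ae_map measurable_snd.aemeasurable (potential_absolutelyContinuous h h1)
  refine lintegral_eq_zero_of_ae_eq_zero ?_
  filter_upwards [h2] with p hp
  refine lintegral_eq_zero_of_ae_eq_zero ?_
  filter_upwards [measure_eq_zero_iff_ae_notMem.1 hp] with x hx
  rw [indicator_of_notMem (show (p.2, x) ∉ N from hx)]
  simp

lemma lintegral_jointDensity_mul (h : IsPC k ℓ) (hg : Measurable g) {F : ℝ × E → ℝ≥0∞}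
    (hF : Measurable F) :
    ∫⁻ t, ∫⁻ x, jointDensity h g (t, x) * F (t, x) =
      ∫⁻ p, (∫⁻ x, g (p.1, x) * F (p.2, x)) ∂(occupation h) := by
  have hm := measurable_jointDensity h g
  rw [← lintegral_jointMeasure h hg hF, ← Measure.withDensity_rnDeriv_eq _ _
    (jointMeasure_absolutelyContinuous h hg),
    lintegral_withDensity_eq_lintegral_mul _ (Measure.measurable_rnDeriv _ _) hF,
    lintegral_prod _ (by fun_prop)]
  rfl

/-- Integrating out `x` replaces `g(τ, ·)` by one and leaves `∫₀^∞ P_τ(B) dτ`. -/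
lemma setLIntegral_jointDensity (h : IsPC k ℓ) (hg : Measurable g)
    (hg1 : ∀ τ, 0 < τ → ∫⁻ x, g (τ, x) = 1) {B : Set ℝ} (hB : MeasurableSet B) :
    ∫⁻ t in B, ∫⁻ x, jointDensity h g (t, x) = potential h B := by
  have hm := measurable_jointDensity h g
  have hF : Measurable fun q : ℝ × E => B.indicator (1 : ℝ → ℝ≥0∞) q.1 :=
    (measurable_one.indicator hB).comp measurable_fst
  have h1 := lintegral_jointDensity_mul h hg hF
  have h2 : ∫⁻ t, ∫⁻ x, jointDensity h g (t, x) * B.indicator (1 : ℝ → ℝ≥0∞) t =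
      ∫⁻ t in B, ∫⁻ x, jointDensity h g (t, x) := by
    rw [← lintegral_indicator hB]
    refine lintegral_congr fun t => ?_
    by_cases ht : t ∈ B <;> simp [ht]
  rw [← h2, h1, lintegral_occupation h, potential_apply h hB]
  · refine setLIntegral_congr_fun measurableSet_Ioi fun τ hτ => ?_
    have h3 : Measurable fun x => g (τ, x) := by fun_prop
    simp_rw [lintegral_mul_const _ h3, hg1 τ hτ, one_mul]
    exact lintegral_indicator_one hB
  · exact Measurable.lintegral_prod_right'
      (f := fun q : (ℝ × ℝ) × E => g (q.1.1, q.2) * B.indicator (1 : ℝ → ℝ≥0∞) q.1.2)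
      ((by fun_prop : Measurable fun q : (ℝ × ℝ) × E => g (q.1.1, q.2)).mul
        ((measurable_one.indicator hB).comp (by fun_prop)))

/-- The time marginal has density `ℓ`. -/
lemma ae_lintegral_jointDensity (h : IsPC k ℓ) (hg : Measurable g)
    (hg1 : ∀ τ, 0 < τ → ∫⁻ x, g (τ, x) = 1) :
    ∀ᵐ t ∂halfLine, ∫⁻ x, jointDensity h g (t, x) = ENNReal.ofReal (ℓ t) := by
  have hm : Measurable fun t => ∫⁻ x, jointDensity h g (t, x) :=
    (measurable_jointDensity h g).lintegral_prod_right'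
  have : SigmaFinite halfLine := by unfold halfLine; infer_instance
  refine (withDensity_eq_iff_of_sigmaFinite hm.aemeasurable
    (aemeasurable_of_locallyIntegrableOn h.locallyIntegrable_l).ennreal_ofReal).1 ?_
  refine Measure.ext fun B hB => ?_
  have h1 : halfLine.withDensity (fun t => ENNReal.ofReal (ℓ t)) B = potential h (B ∩ Ioi 0) := by
    rw [← (nonneg_and_posPartMeasure_l h).2, posPartMeasure, withDensity_apply _ hB,
      withDensity_apply _ (hB.inter measurableSet_Ioi), halfLine, Measure.restrict_restrict hB,
      Measure.restrict_restrict (hB.inter measurableSet_Ioi), inter_assoc, inter_self]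
  rw [h1, ← setLIntegral_jointDensity h hg hg1 (hB.inter measurableSet_Ioi),
    withDensity_apply _ hB, halfLine, Measure.restrict_restrict hB]

lemma lintegral_sectionMeasure_Iio (h : IsPC k ℓ) (hg : Measurable g)
    (hg1 : ∀ τ, 0 < τ → ∫⁻ x, g (τ, x) = 1) (t : ℝ) :
    ∫⁻ x, sectionMeasure h g x (Iio t) = potential h (Iio t) := by
  have hm := measurable_jointDensity h g
  rw [← setLIntegral_jointDensity h hg hg1 measurableSet_Iio, lintegral_lintegral_swap]
  · simp [sectionMeasure, withDensity_apply _ measurableSet_Iio]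
  · exact hm.aemeasurable

/-- The integral over `x` of these masses is `potential h (Iio t)`, which is finite, and zero for `t
= 0`. Natural `t` suffice by monotonicity. -/
lemma ae_sectionMeasure_Iio (h : IsPC k ℓ) (hg : Measurable g)
    (hg1 : ∀ τ, 0 < τ → ∫⁻ x, g (τ, x) = 1) :
    ∀ᵐ x, sectionMeasure h g x (Iio 0) = 0 ∧ ∀ t, sectionMeasure h g x (Iio t) ≠ ∞ := by
  have h0 : ∀ᵐ x, sectionMeasure h g x (Iio 0) = 0 := by
    have := lintegral_sectionMeasure_Iio h hg hg1 0
    rw [potential_Iio_zero h, lintegral_eq_zero_iff (measurable_sectionMeasure_Iio h g 0)] at this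
    exact this
  have h1 : ∀ᵐ x, ∀ n : ℕ, sectionMeasure h g x (Iio (n : ℝ)) < ∞ := by
    refine ae_all_iff.2 fun n => ae_lt_top (measurable_sectionMeasure_Iio h g n) ?_
    rw [lintegral_sectionMeasure_Iio h hg hg1]
    exact potential_Iio_ne_top h n
  filter_upwards [h0, h1] with x hx0 hx1
  refine ⟨hx0, fun t => ?_⟩
  obtain ⟨n, hn⟩ := exists_nat_gt t
  exact ((measure_mono (Iio_subset_Iio hn.le)).trans_lt (hx1 n)).ne

/-- The density of the joint measure solves the Volterra equation. -/
lemma ae_volterra_jointDensity (h : IsPC k ℓ) (hg : Measurable g) :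
    ∀ᵐ x : E, ∀ᵐ t, ∫⁻ s, kernelDensity k (t - s) ∂(sectionMeasure h g x) =
      subordinated h g t x := by
  have hm := measurable_jointDensity h g
  have hK := measurable_kernelDensity h.antitone_k
  have hA : Measurable fun q : ℝ × E =>
      ∫⁻ s, jointDensity h g (s, q.2) * kernelDensity k (q.1 - s) :=
    Measurable.lintegral_prod_right' (f := fun r : (ℝ × E) × ℝ =>
      jointDensity h g (r.2, r.1.2) * kernelDensity k (r.1.1 - r.2)) (by fun_prop)
  have hB : Measurable fun q : ℝ × E => subordinated h g q.1 q.2 :=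
    Measurable.lintegral_prod_right' (f := fun r : (ℝ × E) × (ℝ × ℝ) =>
      g (r.2.1, r.1.2) * kernelDensity k (r.1.1 - r.2.2)) (by fun_prop)
  have key : (fun q : ℝ × E => ∫⁻ s, jointDensity h g (s, q.2) * kernelDensity k (q.1 - s))
      =ᵐ[(volume : Measure ℝ).prod volume] fun q => subordinated h g q.1 q.2 := by
    refine ae_eq_of_forall_setLIntegral_eq_of_sigmaFinite hA hB fun S hS _ => ?_
    set Φ : ℝ × E → ℝ≥0∞ := S.indicator 1 with hΦ
    have hΦm : Measurable Φ := measurable_one.indicator hS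
    have hΦt : ∀ q, Φ q ≠ ∞ := fun q => by
      simp only [hΦ, indicator]; split_ifs <;> simp
    have hS' : ∀ F : ℝ × E → ℝ≥0∞, Measurable F → ∫⁻ q in S, F q ∂((volume : Measure ℝ).prod volume)
        = ∫⁻ x, ∫⁻ t, Φ (t, x) * F (t, x) := by
      intro F hF
      rw [← lintegral_indicator hS, lintegral_prod_symm _ (hF.indicator hS).aemeasurable]
      refine lintegral_congr fun x => lintegral_congr fun t => ?_
      by_cases hq : (t, x) ∈ S <;> simp [hΦ, hq]
    rw [hS' _ hA, hS' _ hB]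
    -- `J` is the adjoint convolution: with `k` moved onto the test function `Φ`, both sides reduce
    -- to integrals of `J` against the joint measure.
    set J : ℝ × E → ℝ≥0∞ := fun r => ∫⁻ t, Φ (t, r.2) * kernelDensity k (t - r.1) with hJ
    have hJm : Measurable J := Measurable.lintegral_prod_right' (f := fun r : (ℝ × E) × ℝ =>
      Φ (r.2, r.1.2) * kernelDensity k (r.2 - r.1.1)) (by fun_prop)
    calc ∫⁻ x, ∫⁻ t, Φ (t, x) * ∫⁻ s, jointDensity h g (s, x) * kernelDensity k (t - s)
        = ∫⁻ x, ∫⁻ s, jointDensity h g (s, x) * J (s, x) := by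
          refine lintegral_congr fun x => ?_
          simp_rw [← lintegral_const_mul' _ _ (hΦt _)]
          rw [lintegral_lintegral_swap (by fun_prop)]
          refine lintegral_congr fun s => ?_
          rw [← lintegral_const_mul _ (by fun_prop)]
          refine lintegral_congr fun t => ?_
          ring
      _ = ∫⁻ p, (∫⁻ x, g (p.1, x) * J (p.2, x)) ∂(occupation h) := by
          rw [lintegral_lintegral_swap (by fun_prop), lintegral_jointDensity_mul h hg hJm]
      _ = ∫⁻ x, ∫⁻ p, g (p.1, x) * J (p.2, x) ∂(occupation h) := by
          rw [lintegral_lintegral_swap (by fun_prop)]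
      _ = ∫⁻ x, ∫⁻ t, Φ (t, x) * subordinated h g t x := by
          refine lintegral_congr fun x => ?_
          simp_rw [subordinated, ← lintegral_const_mul' _ _ (hΦt _)]
          symm
          rw [lintegral_lintegral_swap (by fun_prop)]
          refine lintegral_congr fun p => ?_
          rw [← lintegral_const_mul _ (by fun_prop)]
          refine lintegral_congr fun t => ?_
          ring
  have key' := (Measure.measurePreserving_swap (μ := (volume : Measure E))
    (ν := (volume : Measure ℝ))).quasiMeasurePreserving.ae key
  filter_upwards [Measure.ae_ae_of_ae_prod key'] with x hx
  filter_upwards [hx] with t ht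
  rw [sectionMeasure, lintegral_withDensity_eq_lintegral_mul _ (by fun_prop) (by fun_prop)]
  exact ht

end Joint

/-! ### The kernel `Z` and the Volterra equation -/

variable {k ℓ : ℝ → ℝ} {d : ℕ} {ρ : ℝ} {g : ℝ × EuclideanSpace ℝ (Fin d) → ℝ≥0∞}

/-- No integrability in `τ` is needed: where the integral diverges, the Bochner integral and
`toReal` both return zero. -/
lemma Z_eq_toReal (hg : Measurable g) (hg0 : ∀ τ, 0 < τ → ∀ x, 0 ≤ stableDensity d ρ τ x)
    (hgη : ∀ τ, 0 < τ → ∀ x, g (τ, x) = ENNReal.ofReal (stableDensity d ρ τ x)) (t : ℝ)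
    (x : EuclideanSpace ℝ (Fin d)) :
    Z k d ρ t x = (∫⁻ τ in Ioi 0, g (τ, x) ∂(propagationMeasure k t)).toReal := by
  have h1 : ∀ τ ∈ Ioi (0 : ℝ), stableDensity d ρ τ x = (g (τ, x)).toReal := fun τ hτ => by
    rw [hgη τ hτ, ENNReal.toReal_ofReal (hg0 τ hτ x)]
  have hgx : Measurable fun τ => g (τ, x) := by fun_prop
  rw [Z, setIntegral_congr_fun measurableSet_Ioi h1, integral_toReal hgx.aemeasurable]
  filter_upwards [ae_restrict_mem measurableSet_Ioi] with τ hτ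
  rw [hgη τ hτ]
  exact ENNReal.ofReal_lt_top

lemma integrable_and_integral_Z (h : IsPC k ℓ) (hρ : ρ = 2 ∨ (ρ = 1 ∧ d = 1)) {t : ℝ}
    (ht : 0 < t) : Integrable (fun x : EuclideanSpace ℝ (Fin d) => Z k d ρ t x) ∧
      ∫ x : EuclideanSpace ℝ (Fin d), Z k d ρ t x = 1 := by
  obtain ⟨g, hg, hG⟩ := exists_stableDensity hρ
  simp_rw [Z_eq_toReal hg (fun τ hτ => (hG τ hτ).1) (fun τ hτ => (hG τ hτ).2.1)]
  have hfin : IsFiniteMeasure ((propagationMeasure k t).restrict (Ioi 0)) := by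
    refine ⟨?_⟩
    rw [Measure.restrict_apply_univ, propagationMeasure_Ioi h ht]
    exact ENNReal.one_lt_top
  have hm : Measurable fun x => ∫⁻ τ in Ioi 0, g (τ, x) ∂(propagationMeasure k t) :=
    hg.lintegral_prod_left'
  have h1 : ∫⁻ x, ∫⁻ τ in Ioi 0, g (τ, x) ∂(propagationMeasure k t) = 1 := by
    rw [lintegral_lintegral_swap (by fun_prop)]
    rw [setLIntegral_congr_fun (g := fun _ => 1) measurableSet_Ioi fun τ hτ => (hG τ hτ).2.2]
    simp [propagationMeasure_Ioi h ht]
  have hne : ∫⁻ x, ∫⁻ τ in Ioi 0, g (τ, x) ∂(propagationMeasure k t) ≠ ∞ := by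
    rw [h1]; exact ENNReal.one_ne_top
  refine ⟨integrable_toReal_of_lintegral_ne_top hm.aemeasurable hne, ?_⟩
  rw [integral_toReal hm.aemeasurable (ae_lt_top hm hne), h1, ENNReal.toReal_one]

lemma ae_Z_eq (h : IsPC k ℓ) (hg : Measurable g)
    (hg0 : ∀ τ, 0 < τ → ∀ x, 0 ≤ stableDensity d ρ τ x)
    (hgη : ∀ τ, 0 < τ → ∀ x, g (τ, x) = ENNReal.ofReal (stableDensity d ρ τ x)) :
    ∀ᵐ x : EuclideanSpace ℝ (Fin d), ∀ᵐ t ∂halfLine,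
      Z k d ρ t x = (∫⁻ s, kernelDensity k (t - s) ∂(sectionMeasure h g x)).toReal := by
  filter_upwards [ae_volterra_jointDensity h hg] with x hx
  filter_upwards [ae_lintegral_propagationMeasure h hg, ae_restrict_of_ae hx] with t h1 h2
  rw [Z_eq_toReal hg hg0 hgη, h1 x, h2]

lemma isVolterraSolution_solution (h : IsPC k ℓ) (hg : Measurable g)
    (hg0 : ∀ τ, 0 < τ → ∀ x, 0 ≤ stableDensity d ρ τ x)
    (hgη : ∀ τ, 0 < τ → ∀ x, g (τ, x) = ENNReal.ofReal (stableDensity d ρ τ x))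
    (hg1 : ∀ τ, 0 < τ → ∫⁻ x, g (τ, x) = 1) : IsVolterraSolution k d ρ (solution h g) := by
  refine ⟨(measurable_solution h g).aestronglyMeasurable, ?_, ?_⟩
  · filter_upwards [ae_sectionMeasure_Iio h hg hg1] with x hx
    exact locallyIntegrableOn_solution h hx.2
  · filter_upwards [ae_sectionMeasure_Iio h hg hg1, ae_Z_eq h hg hg0 hgη] with x hx hZ
    have hpos := posPartMeasure_solution h hx.1 hx.2
    have hneg : posPartMeasure (fun t => -solution h g t x) = 0 := by
      have : posPartMeasure (fun t => -solution h g t x) = halfLine.withDensity 0 := by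
        refine withDensity_congr_ae (ae_of_all _ fun t => ?_)
        exact ENNReal.ofReal_of_nonpos (neg_nonpos.2 ENNReal.toReal_nonneg)
      rw [this, withDensity_zero]
    filter_upwards [hZ, ae_restrict_mem measurableSet_Ioi,
      ae_restrict_of_ae (ae_kernelDensity_conv_lt_top h hx.1 hx.2)] with t h1 ht h2
    rw [timeConv_comm, timeConv_eq_sub h
      (aemeasurable_of_locallyIntegrableOn (locallyIntegrableOn_solution h hx.2)) ht
      (by rw [hpos]; exact h2) (by rw [hneg]; simp), hpos, hneg, h1]
    simp

/-- For almost every fixed `x`, cancellation of `k` determines `Y(·, x)` without any sign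
assumption. The remaining work exchanges "almost all `x`" with "almost all `t`". -/
lemma IsVolterraSolution.ae_eq_solution {Y : ℝ → EuclideanSpace ℝ (Fin d) → ℝ}
    (hY : IsVolterraSolution k d ρ Y) (h : IsPC k ℓ) (hg : Measurable g)
    (hg0 : ∀ τ, 0 < τ → ∀ x, 0 ≤ stableDensity d ρ τ x)
    (hgη : ∀ τ, 0 < τ → ∀ x, g (τ, x) = ENNReal.ofReal (stableDensity d ρ τ x))
    (hg1 : ∀ τ, 0 < τ → ∫⁻ x, g (τ, x) = 1) :
    ∀ᵐ t ∂halfLine, ∀ᵐ x, Y t x = solution h g t x := by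
  have : SigmaFinite halfLine := by unfold halfLine; infer_instance
  have hxt : ∀ᵐ x, ∀ᵐ t ∂halfLine, Y t x = solution h g t x := by
    filter_upwards [ae_sectionMeasure_Iio h hg hg1, ae_Z_eq h hg hg0 hgη, hY.locallyIntegrable,
      hY.volterra] with x hx hZ hloc hvol
    obtain ⟨h1, h2⟩ := nonneg_and_posPartMeasure_eq h hloc hx.1 hx.2 (by
      filter_upwards [hZ, hvol] with t ht1 ht2
      rw [timeConv_comm, ht2, ht1])
    rw [← posPartMeasure_solution h hx.1 hx.2] at h2
    have h3 := (withDensity_eq_iff_of_sigmaFinite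
      (aemeasurable_of_locallyIntegrableOn hloc).ennreal_ofReal
      (aemeasurable_of_locallyIntegrableOn
        (locallyIntegrableOn_solution h hx.2)).ennreal_ofReal).1 h2
    filter_upwards [h1, h3] with t ht1 ht3
    exact (ENNReal.ofReal_eq_ofReal_iff ht1 ENNReal.toReal_nonneg).1 ht3
  -- Exchanging the two quantifiers requires a measurable set in the product, hence a measurable
  -- representative of `Y`.
  obtain ⟨Y', hY'm, hY'⟩ := hY.measurable
  change Function.uncurry Y =ᵐ[halfLine.prod volume] Y' at hY'
  have h1 : ∀ᵐ t ∂halfLine, ∀ᵐ x, Y t x = Y' (t, x) := Measure.ae_ae_of_ae_prod hY'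
  have h2 : ∀ᵐ x, ∀ᵐ t ∂halfLine, Y t x = Y' (t, x) :=
    Measure.ae_ae_of_ae_prod ((Measure.measurePreserving_swap
      (μ := (volume : Measure (EuclideanSpace ℝ (Fin d)))) (ν := halfLine)).quasiMeasurePreserving.ae
        hY')
  have h3 : ∀ᵐ x, ∀ᵐ t ∂halfLine, Y' (t, x) = solution h g t x := by
    filter_upwards [hxt, h2] with x hx1 hx2
    filter_upwards [hx1, hx2] with t ht1 ht2
    rw [← ht2, ht1]
  have h4 : ∀ᵐ t ∂halfLine, ∀ᵐ x, Y' (t, x) = solution h g t x := by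
    rw [Measure.ae_ae_comm]
    · exact h3
    · exact measurableSet_eq_fun hY'm.measurable (measurable_solution h g)
  filter_upwards [h1, h4] with t ht1 ht4
  filter_upwards [ht1, ht4] with x hx1 hx4
  rw [hx1, hx4]

/-- The time marginal is known as `ENNReal.ofReal (ℓ t)`; the derived nonnegativity of `ℓ` turns it
into `ℓ t`. -/
lemma ae_integrable_solution (h : IsPC k ℓ) (hg : Measurable g)
    (hg1 : ∀ τ, 0 < τ → ∫⁻ x, g (τ, x) = 1) :
    ∀ᵐ t ∂halfLine, Integrable (fun x => solution h g t x) ∧ ∫ x, solution h g t x = ℓ t := by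
  have hm := measurable_jointDensity h g
  filter_upwards [ae_lintegral_jointDensity h hg hg1, (nonneg_and_posPartMeasure_l h).1]
    with t ht ht0
  have htm : Measurable fun x => jointDensity h g (t, x) := by fun_prop
  have hne : ∫⁻ x, jointDensity h g (t, x) ≠ ∞ := by rw [ht]; exact ENNReal.ofReal_ne_top
  refine ⟨integrable_toReal_of_lintegral_ne_top htm.aemeasurable hne, ?_⟩
  unfold solution
  rw [integral_toReal htm.aemeasurable (ae_lt_top htm hne), ht, ENNReal.toReal_ofReal ht0]

end Subordination

open MeasureTheory Set Subordination in
theorem mainTheorem10 (k ℓ : ℝ → ℝ) (hkl : IsPC k ℓ) (d : ℕ) (hd : 1 ≤ d) (ρ : ℝ)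
    (hρ : ρ = 2 ∨ (ρ = 1 ∧ d = 1)) :
    (∀ t : ℝ, 0 < t →
      Integrable (fun x : EuclideanSpace ℝ (Fin d) => Z k d ρ t x) ∧
        ∫ x : EuclideanSpace ℝ (Fin d), Z k d ρ t x = 1) ∧
    (∃ Y : ℝ → EuclideanSpace ℝ (Fin d) → ℝ, IsVolterraSolution k d ρ Y) ∧
    (∀ Y : ℝ → EuclideanSpace ℝ (Fin d) → ℝ, IsVolterraSolution k d ρ Y →
      ∀ᵐ t ∂(volume.restrict (Ioi (0 : ℝ))),
        Integrable (fun x : EuclideanSpace ℝ (Fin d) => Y t x) ∧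
          ∫ x : EuclideanSpace ℝ (Fin d), Y t x = ℓ t) := by
  obtain ⟨g, hg, hG⟩ := exists_stableDensity hρ
  have hg0 := fun τ hτ => (hG τ hτ).1
  have hgη := fun τ hτ => (hG τ hτ).2.1
  have hg1 := fun τ hτ => (hG τ hτ).2.2
  refine ⟨fun t ht => integrable_and_integral_Z hkl hρ ht,
    ⟨_, isVolterraSolution_solution hkl hg hg0 hgη hg1⟩, fun Y hY => ?_⟩
  filter_upwards [hY.ae_eq_solution hkl hg hg0 hgη hg1, ae_integrable_solution hkl hg hg1]
    with t h1 h2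
  exact ⟨h2.1.congr (Filter.EventuallyEq.symm h1), (integral_congr_ae h1).trans h2.2⟩
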